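/- Let $0<p<1$ and $q\in\mathbb N$ with $q\ge 2$. For a complex square matrix $M$ let $E_{p,p}(M)=\sum_{k\ge 0} M^k/\Gamma(pk+p)$. Let $A=\operatorname{diag}(J_1,\dots,J_l)$, where $J_j$ is the $n_j\times n_j$ Jordan block with eigenvalue $\lambda_j\in\mathbb C\setminus\{0\}$ and ones on the superdiagonal, and assume $|\arg\lambda_j|\ne p\pi/2$ for all $j$ (principal argument). The block $J_j$ is called stable if $|\arg\lambda_j|>p\pi/2$ and unstable if $|\arg\lambda_j|<p\pi/2$. Then for all $t>0$ and all $j$ the series for $E_{p,p}(t^pJ_j)$ and $E_{p,p}(t^pA)$ converge and $$E_{p,p}(t^pJ_j)=t^{-p}\,\widetilde B_j(t)+\widetilde C_j(t),$$ where $\widetilde B_j(t)=0$ if $J_j$ is stable; if $J_j$ is unstable, $\widetilde B_j(t)$ is the $n_j\times n_j$ upper triangular Toeplitz matrix with first row $\widetilde\Psi_0(t,\lambda_j),\dots,\widetilde\Psi_{n_j-1}(t,\lambda_j)$, $$\widetilde\Psi_m(t,\lambda_j)=\frac1{m!}\,\frac{\partial^{m+1}}{\partial\lambda^{m+1}}\exp\bigl(t\lambda^{1/p}\bigr)\Big|_{\lambda=\lambda_j}\quad\text{(principal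 power)};$$ and $\widetilde C_j(t)$ is, for every $j$, the $n_j\times n_j$ upper triangular Toeplitz matrix with first row $\widetilde\Delta_0(t,\lambda_j),\dots,\widetilde\Delta_{n_j-1}(t,\lambda_j)$, $$\widetilde\Delta_m(t,\lambda_j)=\frac1{m!}\left(\sum_{k=2}^{q}(-1)^{m+1}\frac{(k+m-1)!}{(k-1)!}\,\frac{\lambda_j^{-k-m}\,t^{-pk}}{\Gamma(p-pk)}+O\bigl(|\lambda_j|^{-q-m}\,t^{-p-pq}\bigr)\right)\qquad(t\to\infty),$$ with $1/\Gamma=0$ at the poles of $\Gamma$. The implied constant, and the threshold beyond which the bound holds, depend only on $p$, $q$, $m$, on a positive lower bound for $|\lambda_j|$ and on a positive lower bound for $\bigl||\arg\lambda_j|-p\pi/2\bigr|$. Moreover, with $\widetilde B(t)=\operatorname{diag}(\widetilde B_1(t),\dots,\widetilde B_l(t))$ and $\widetilde C(t)=\operatorname{diag}(\widetilde C_1(t),\dots,\widetilde C_l(t))$, $$E_{p,p}(t^pA)=t^{-p}\,\widetilde B(t)+\widetilde C(t)\qquad(t>0).$$ -/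

import Mathlib

open scoped Nat

noncomputable section

/-- The `k`-th term `M ^ k / Γ(α k + β)` of the two-parameter Mittag-Leffler series. -/
def mittagLefflerTerm {ι : Type} [Fintype ι] [DecidableEq ι] (α β : ℝ)
    (M : Matrix ι ι ℂ) (k : ℕ) : Matrix ι ι ℂ :=
  (((Real.Gamma (α * k + β))⁻¹ : ℝ) : ℂ) • M ^ k

/-- The two-parameter Mittag-Leffler function of a matrix, `E_{α,β}(M) = ∑ₖ M ^ k / Γ(α k + β)`. -/
def mittagLeffler {ι : Type} [Fintype ι] [DecidableEq ι] (α β : ℝ)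
    (M : Matrix ι ι ℂ) : Matrix ι ι ℂ :=
  ∑' k : ℕ, mittagLefflerTerm α β M k

/-- The `n × n` Jordan block with eigenvalue `z` (ones on the superdiagonal). -/
def jordanBlock (n : ℕ) (z : ℂ) : Matrix (Fin n) (Fin n) ℂ :=
  Matrix.of fun i k => if i = k then z else if (i : ℕ) + 1 = (k : ℕ) then 1 else 0

/-- The `n × n` upper triangular Toeplitz matrix with first row `a 0, a 1, …, a (n - 1)`. -/
def upperToeplitz (n : ℕ) (a : ℕ → ℂ) : Matrix (Fin n) (Fin n) ℂ :=
  Matrix.of fun i k => if i ≤ k then a ((k : ℕ) - (i : ℕ)) else 0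

/-- `Ψ̃_m(t, z) = (1 / m!) ∂^{m+1}/∂z^{m+1} exp(t z^{1/p})`, with the principal power. -/
def psiTilde (p : ℝ) (m : ℕ) (t : ℝ) (z : ℂ) : ℂ :=
  (1 / (m ! : ℂ)) *
    iteratedDeriv (m + 1) (fun w : ℂ => Complex.exp ((t : ℂ) * w ^ ((1 / p : ℝ) : ℂ))) z

/-- The block `B̃_j(t)`: zero for a stable eigenvalue (`|arg z| > p π / 2`), and otherwise the
upper triangular Toeplitz matrix with entries `Ψ̃_m(t, z)`. -/
def blockB (p : ℝ) (n : ℕ) (z : ℂ) (t : ℝ) : Matrix (Fin n) (Fin n) ℂ :=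
  if p * Real.pi / 2 < |Complex.arg z| then 0
  else upperToeplitz n fun m => psiTilde p m t z

/-- The explicit algebraic part of `m! Δ̃_m(t, z)`:
`∑_{k=2}^q (-1)^{m+1} ((k+m-1)! / (k-1)!) z^{-k-m} t^{-pk} / Γ(p - pk)`.
At a pole of `Γ` Mathlib has `Γ = 0`, so that `1 / Γ = 0` there, as usual. -/
def deltaSum (p : ℝ) (q m : ℕ) (t : ℝ) (z : ℂ) : ℂ :=
  ∑ k ∈ Finset.Icc 2 q,
    (-1 : ℂ) ^ (m + 1) * (((k + m - 1)! : ℂ) / ((k - 1)! : ℂ)) *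
      (z ^ (-(k : ℤ) - (m : ℤ)) * ((t ^ (-(p * k)) : ℝ) : ℂ)
        / ((Real.Gamma (p - p * k) : ℝ) : ℂ))

/-- The block `C̃_j(t)`: the upper triangular Toeplitz matrix with entries
`Δ̃_m(t, z) = (1 / m!) (deltaSum + ρ_m(t))`, where `ρ_m(t)` is the remainder. -/
def blockC (p : ℝ) (q n : ℕ) (z : ℂ) (ρ : ℕ → ℝ → ℂ) (t : ℝ) : Matrix (Fin n) (Fin n) ℂ :=
  upperToeplitz n fun m => (1 / (m ! : ℂ)) * (deltaSum p q m t z + ρ m t)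

end

section

open MeasureTheory Set Filter Topology Complex intervalIntegral

/-! Everything rests on the contour formula `E_{p,p}(w) = (1/2πi) ∫ e^u / (u^p - w) du` over a
Hankel path. It comes from Hankel's formula for `1/Γ` (`hankelIntegral_exp_exp`) by summing a
geometric series (`hasSum_hankelIntegral_kernel`). In the coordinate `u = e^s` the rays `arg u = ±θ`
become the lines `Im s = ±θ`, so that only rectangles are needed and no branch of `u^p` has to be
chosen.

Let `π/2 < θ < π`, with `pθ` slightly above `pπ/2`. Shrinking the path onto the two rays crosses no
pole if `w` is stable, and exactly the pole `s = log w / p` if `w` is unstable; its residue is the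
exponential term (`scalarMittagLeffler_eq_of_stable`, `scalarMittagLeffler_eq_of_unstable`). On the
rays, expanding `1/(u^p - w)` in powers of `1/w` gives the algebraic terms, with a remainder
`O(|w|^{-q-1})` uniform on cones away from the critical rays (`exists_norm_lineDiff_le`).

Put `w = t^p z`. Cauchy's estimate on a disc of radius proportional to `|z|` carries the remainder
over to all derivatives in `z` (`exists_norm_iteratedDeriv_sub_le`). These derivatives, divided by
`m!`, are the entries of `E_{p,p}(t^p J)` for a Jordan block `J`
(`hasSum_mittagLefflerTerm_jordanBlock`). -/

/-! ### Contour integrals in the coordinate `u = e^s`. -/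

theorem integrableOn_exp_neg_mul_exp_Ioi {κ : ℝ} (hκ : 0 < κ) (a x₀ : ℝ) :
    IntegrableOn (fun x : ℝ => Real.exp (-κ * Real.exp x + a * x)) (Ioi x₀) := by
  refine integrable_of_isBigO_exp_neg (b := 1) one_pos (by fun_prop) ?_
  have h : Tendsto (fun x : ℝ => (Real.exp x) ^ (a + 1) * Real.exp (-κ * Real.exp x)) atTop (𝓝 0) :=
    (tendsto_rpow_mul_exp_neg_mul_atTop_nhds_zero (a + 1) κ hκ).comp Real.tendsto_exp_atTop
  have h2 := (h.isBigO_one ℝ).mul (Asymptotics.isBigO_refl (fun x : ℝ => Real.exp (-1 * x)) atTop)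
  refine h2.congr (fun x => ?_) (fun x => by simp)
  rw [← Real.exp_mul, ← Real.exp_add, ← Real.exp_add]
  ring_nf

theorem integrable_exp_neg_mul_exp {κ : ℝ} (hκ : 0 < κ) {a : ℝ} (ha : 0 < a) :
    Integrable (fun x : ℝ => Real.exp (-κ * Real.exp x + a * x)) := by
  rw [← integrableOn_univ, ← Iic_union_Ioi (a := (0 : ℝ))]
  refine IntegrableOn.union ?_ (integrableOn_exp_neg_mul_exp_Ioi hκ a 0)
  refine Integrable.mono' (integrableOn_exp_mul_Iic ha 0) (by fun_prop) ?_
  refine Eventually.of_forall fun x => ?_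
  rw [Real.norm_eq_abs, abs_of_pos (Real.exp_pos _), Real.exp_le_exp]
  nlinarith [Real.exp_pos x]

/-- The integral of `F` along the path that comes in from `+∞ - iθ` to `x₀ - iθ`, goes up to
`x₀ + iθ`, and leaves to `+∞ + iθ`. -/
noncomputable def hankelIntegral (θ x₀ : ℝ) (F : ℂ → ℂ) : ℂ :=
  I * (∫ y in (-θ)..θ, F (x₀ + y * I)) + (∫ x in Ioi x₀, F (x + θ * I))
    - ∫ x in Ioi x₀, F (x + (-θ : ℝ) * I)

/-- The difference of the integrals of `F` along the lines `Im s = θ` and `Im s = -θ`. -/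
noncomputable def lineDiff (θ : ℝ) (F : ℂ → ℂ) : ℂ :=
  (∫ x : ℝ, F (x + θ * I)) - ∫ x : ℝ, F (x + (-θ : ℝ) * I)

/-- The integral of `F` along the boundary of `[x₁, x₀] × [-θ, θ]`. -/
noncomputable def rectIntegral (θ x₁ x₀ : ℝ) (F : ℂ → ℂ) : ℂ :=
  (∫ x in x₁..x₀, F (x + (-θ : ℝ) * I)) - (∫ x in x₁..x₀, F (x + θ * I))
    + I * (∫ y in (-θ)..θ, F (x₀ + y * I)) - I * ∫ y in (-θ)..θ, F (x₁ + y * I)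

theorem hankelIntegral_sub_eq_rectIntegral {θ x₁ x₀ : ℝ} {F : ℂ → ℂ} (h : x₁ ≤ x₀)
    (h₁ : IntegrableOn (fun x : ℝ => F (x + θ * I)) (Ioi x₁))
    (h₂ : IntegrableOn (fun x : ℝ => F (x + (-θ : ℝ) * I)) (Ioi x₁)) :
    hankelIntegral θ x₀ F = hankelIntegral θ x₁ F + rectIntegral θ x₁ x₀ F := by
  have e : ∀ G : ℝ → ℂ, IntegrableOn G (Ioi x₁) →
      ∫ x in Ioi x₁, G x = (∫ x in x₁..x₀, G x) + ∫ x in Ioi x₀, G x := by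
    intro G hG
    rw [integral_of_le h, ← setIntegral_union (Ioc_disjoint_Ioi le_rfl) measurableSet_Ioi
      (hG.mono_set Ioc_subset_Ioi_self) (hG.mono_set (Ioi_subset_Ioi h)), Ioc_union_Ioi_eq_Ioi h]
  rw [hankelIntegral, hankelIntegral, rectIntegral, e _ h₁, e _ h₂]
  ring

theorem rectIntegral_eq_zero {θ x₁ x₀ : ℝ} {F : ℂ → ℂ} (h : x₁ ≤ x₀) (hθ : 0 ≤ θ)
    (hF : ∀ s : ℂ, x₁ ≤ s.re → s.re ≤ x₀ → |s.im| ≤ θ → DifferentiableAt ℂ F s) :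
    rectIntegral θ x₁ x₀ F = 0 := by
  have := integral_boundary_rect_eq_zero_of_differentiableOn F
    (x₁ + (-θ : ℝ) * I) (x₀ + θ * I) (by
      intro s hs
      simp only [mem_reProdIm, add_re, ofReal_re, mul_re, I_re, mul_zero, ofReal_im, I_im, mul_one,
        sub_self, add_zero, add_im, mul_im, zero_add, uIcc_of_le h,
        uIcc_of_le (neg_le_self hθ), mem_Icc] at hs
      exact (hF s hs.1.1 hs.1.2 (abs_le.2 hs.2)).differentiableWithinAt)
  simpa [rectIntegral] using this

/-- Cauchy's formula for the kernel `1 / (s - s₀)` on a rectangle. -/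
theorem rectIntegral_inv_sub {θ x₁ x₀ : ℝ} {s₀ : ℂ} (h₁ : x₁ < s₀.re) (h₀ : s₀.re < x₀)
    (hs : |s₀.im| < θ) :
    rectIntegral θ x₁ x₀ (fun s => (s - s₀)⁻¹) = 2 * Real.pi * I := by
  obtain ⟨hs1, hs2⟩ := abs_lt.1 hs
  have hor : ∀ y : ℝ, y ≠ s₀.im → ∫ x in x₁..x₀, ((x : ℂ) + y * I - s₀)⁻¹ =
      log (x₀ + y * I - s₀) - log (x₁ + y * I - s₀) := by
    intro y hy
    have hsl : ∀ x : ℝ, (x : ℂ) + y * I - s₀ ∈ slitPlane := fun x => by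
      rw [mem_slitPlane_iff]; right; simpa [sub_eq_zero] using hy
    refine integral_eq_sub_of_hasDerivAt (f := fun x : ℝ => log (x + y * I - s₀)) ?_ ?_
    · intro x _
      have : HasDerivAt (fun x : ℝ => (x : ℂ) + y * I - s₀) 1 x :=
        (((hasDerivAt_id x).ofReal_comp).add_const _).sub_const _
      simpa using this.clog_real (hsl x)
    · refine ContinuousOn.intervalIntegrable fun x _ => ContinuousAt.continuousWithinAt ?_
      exact ContinuousAt.inv₀ (by fun_prop) (slitPlane_ne_zero (hsl x))
  -- The sign `ε` picks the branch: `log (s - s₀)` jumps on the left side, so there `log (-(s -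
  -- s₀))` is the primitive.
  have ver : ∀ (x : ℝ) (ε : ℂ), ε = 1 ∨ ε = -1 →
      (∀ y : ℝ, 0 < (ε * (x + y * I - s₀)).re) →
      I * ∫ y in (-θ)..θ, ((x : ℂ) + y * I - s₀)⁻¹ =
      log (ε * (x + θ * I - s₀)) - log (ε * (x + (-θ : ℝ) * I - s₀)) := by
    intro x ε hε hpos
    have hε0 : ε ≠ 0 := by rcases hε with h | h <;> simp [h]
    have hsl : ∀ y : ℝ, ε * ((x : ℂ) + y * I - s₀) ∈ slitPlane := fun y => by
      rw [mem_slitPlane_iff]; left; exact hpos y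
    rw [← intervalIntegral.integral_const_mul]
    refine integral_eq_sub_of_hasDerivAt (f := fun y : ℝ => log (ε * (x + y * I - s₀))) ?_ ?_
    · intro y _
      have : HasDerivAt (fun y : ℝ => ε * ((x : ℂ) + y * I - s₀)) (ε * (1 * I)) y := by
        simpa using
        ((((hasDerivAt_id y).ofReal_comp.mul_const I).const_add (x : ℂ)).sub_const s₀).const_mul ε
      refine (this.clog_real (hsl y)).congr_deriv ?_
      have := right_ne_zero_of_mul (slitPlane_ne_zero (hsl y))
      rw [one_mul, mul_div_mul_left _ _ hε0, div_eq_mul_inv]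
    · refine ContinuousOn.intervalIntegrable fun y _ => ContinuousAt.continuousWithinAt ?_
      exact ContinuousAt.mul (by fun_prop) (ContinuousAt.inv₀ (by fun_prop)
        (right_ne_zero_of_mul (slitPlane_ne_zero (hsl y))))
  rw [rectIntegral, hor θ (by linarith), hor (-θ) (by linarith),
    ver x₀ 1 (Or.inl rfl) (by simpa using h₀),
    ver x₁ (-1) (Or.inr rfl) (by simpa using h₁)]
  -- The change of branch at the two left corners contributes `πi` each; all other corner terms
  -- cancel.
  have hT : log (-1 * (x₁ + θ * I - s₀)) = log (x₁ + θ * I - s₀) - Real.pi * I := by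
    rw [neg_one_mul, log, log, norm_neg, arg_neg_eq_arg_sub_pi_of_im_pos (by simpa using hs2)]
    push_cast; ring
  have hB : log (-1 * (x₁ + (-θ : ℝ) * I - s₀)) = log (x₁ + (-θ : ℝ) * I - s₀) + Real.pi * I := by
    rw [neg_one_mul, log, log, norm_neg, arg_neg_eq_arg_add_pi_of_im_neg (by simpa using hs1)]
    push_cast; ring
  rw [hT, hB]
  simp only [one_mul]
  ring

/-- Pushing the vertical side of the path to `-∞`. -/
theorem hankelIntegral_eq_lineDiff {θ x₀ a C : ℝ} {F : ℂ → ℂ} (hθ : 0 ≤ θ) (ha : 0 < a)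
    (h₁ : Integrable (fun x : ℝ => F (x + θ * I)))
    (h₂ : Integrable (fun x : ℝ => F (x + (-θ : ℝ) * I)))
    {x₂ : ℝ} (hb : ∀ s : ℂ, s.re ≤ x₂ → |s.im| ≤ θ → ‖F s‖ ≤ C * Real.exp (a * s.re))
    {R : ℂ} (hR : ∀ᶠ x₁ in atBot, hankelIntegral θ x₀ F = hankelIntegral θ x₁ F + R) :
    hankelIntegral θ x₀ F = lineDiff θ F + R := by
  have t1 : ∀ G : ℝ → ℂ, Integrable G → Tendsto (fun x₁ => ∫ x in Ioi x₁, G x) atBot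
      (𝓝 (∫ x, G x)) := fun G hG =>
    (aecover_Ioi (μ := volume) (a := fun x : ℝ => x) tendsto_id).integral_tendsto_of_countably_generated hG
  have t2 : Tendsto (fun x₁ : ℝ => I * ∫ y in (-θ)..θ, F (x₁ + y * I)) atBot (𝓝 0) := by
    refine squeeze_zero_norm' (a := fun x₁ : ℝ => C * Real.exp (a * x₁) * |θ - -θ|) ?_ ?_
    · filter_upwards [eventually_le_atBot x₂] with x₁ hx₁
      rw [norm_mul, norm_I, one_mul]
      refine norm_integral_le_of_norm_le_const fun y hy => ?_
      rw [uIoc_of_le (by linarith)] at hy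
      simpa using hb (x₁ + y * I) (by simpa using hx₁) (by simpa using abs_le.2 ⟨hy.1.le, hy.2⟩)
    · have : Tendsto (fun x₁ : ℝ => Real.exp (a * x₁)) atBot (𝓝 0) :=
        Real.tendsto_exp_atBot.comp (tendsto_id.const_mul_atBot ha)
      simpa using (this.const_mul C).mul_const |θ - -θ|
  have t3 : Tendsto (fun x₁ => hankelIntegral θ x₁ F + R) atBot (𝓝 (lineDiff θ F + R)) := by
    simpa [hankelIntegral, lineDiff] using ((t2.add (t1 _ h₁)).sub (t1 _ h₂)).add_const R
  refine tendsto_nhds_unique (tendsto_const_nhds.congr' ?_) t3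
  exact hR

/-! ### Hankel's formula for `1/Γ`. -/

theorem norm_exp_exp_mul (b x y : ℝ) :
    ‖exp (exp (x + y * I) + b * (x + y * I))‖ = Real.exp (Real.cos y * Real.exp x + b * x) := by
  rw [norm_exp]; congr 1
  simp [exp_re]
  ring

theorem integrable_exp_exp_mul {b ϕ : ℝ} (hb : 0 < b) (hϕ : Real.cos ϕ < 0) :
    Integrable fun x : ℝ => exp (exp (x + ϕ * I) + b * (x + ϕ * I)) := by
  refine Integrable.mono' (integrable_exp_neg_mul_exp (neg_pos.2 hϕ) hb)
    (Continuous.aestronglyMeasurable (by fun_prop)) (Eventually.of_forall fun x => ?_)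
  rw [norm_exp_exp_mul, neg_neg]

/-- The line of integration may be moved within a strip where `cos (Im s)` is negative. -/
theorem integral_exp_exp_mul_eq {b α β κ : ℝ} (hb : 0 < b) (hαβ : α ≤ β) (hκ : 0 < κ)
    (hc : ∀ y ∈ Icc α β, Real.cos y ≤ -κ) :
    ∫ x : ℝ, exp (exp (x + α * I) + b * (x + α * I)) =
      ∫ x : ℝ, exp (exp (x + β * I) + b * (x + β * I)) := by
  set F : ℂ → ℂ := fun s => exp (exp s + b * s) with hF
  have hI : ∀ y ∈ Icc α β, Integrable fun x : ℝ => F (x + y * I) := fun y hy =>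
    integrable_exp_exp_mul hb ((hc y hy).trans_lt (neg_neg_of_pos hκ))
  have hline : ∀ y ∈ Icc α β, Tendsto (fun T : ℝ => ∫ x in (-T)..T, F (x + y * I)) atTop
      (𝓝 (∫ x : ℝ, F (x + y * I))) := fun y hy =>
    intervalIntegral_tendsto_integral (hI y hy) tendsto_neg_atTop_atBot tendsto_id
  -- The bound vanishes at both ends: at `+∞` by the double exponential, at `-∞` because `b > 0`.
  have hvert : ∀ l : Filter ℝ, Tendsto (fun T : ℝ => Real.exp (-κ * Real.exp T + b * T)) l (𝓝 0) →
      Tendsto (fun T : ℝ => ∫ y in α..β, F (T + y * I)) l (𝓝 0) := by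
    intro l hl
    refine squeeze_zero_norm (a := fun T => Real.exp (-κ * Real.exp T + b * T) * |β - α|)
      (fun T => ?_) (by simpa using hl.mul_const |β - α|)
    refine norm_integral_le_of_norm_le_const fun y hy => ?_
    rw [uIoc_of_le hαβ] at hy
    rw [hF]
    simp only
    rw [norm_exp_exp_mul, Real.exp_le_exp]
    have := hc y ⟨hy.1.le, hy.2⟩
    gcongr
  have htop := hvert atTop (by
    refine squeeze_zero' (Eventually.of_forall fun _ => (Real.exp_pos _).le)
      (Eventually.of_forall fun T => ?_)
      ((tendsto_rpow_mul_exp_neg_mul_atTop_nhds_zero b κ hκ).comp Real.tendsto_exp_atTop)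
    simp only [Function.comp]
    rw [← Real.exp_mul, ← Real.exp_add, Real.exp_le_exp]
    linarith)
  have hbot := hvert atBot (by
    refine squeeze_zero' (Eventually.of_forall fun _ => (Real.exp_pos _).le)
      (Eventually.of_forall fun T => ?_)
      (Real.tendsto_exp_atBot.comp (tendsto_id.const_mul_atBot hb))
    simp only [Function.comp, id]
    rw [Real.exp_le_exp]
    nlinarith [Real.exp_pos T])
  have hrect : ∀ T : ℝ, (∫ x in (-T)..T, F (x + α * I)) - (∫ x in (-T)..T, F (x + β * I))
      + I * (∫ y in α..β, F (T + y * I)) - I * (∫ y in α..β, F ((-T : ℝ) + y * I)) = 0 := by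
    intro T
    have := integral_boundary_rect_eq_zero_of_differentiableOn F ((-T : ℝ) + α * I) (T + β * I)
      (Differentiable.differentiableOn (by fun_prop))
    simpa using this
  have hlim := (((hline α ⟨le_rfl, hαβ⟩).sub (hline β ⟨hαβ, le_rfl⟩)).add (htop.const_mul I)).sub
    ((hbot.comp tendsto_neg_atTop_atBot).const_mul I)
  simp only [Function.comp, hrect] at hlim
  have := tendsto_nhds_unique hlim tendsto_const_nhds
  simpa [sub_eq_zero] using this

/-- Euler's integral under the substitution `t = e^x`. -/
theorem integral_exp_mul_sub_exp {b : ℝ} (hb : 0 < b) :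
    ∫ x : ℝ, Real.exp (b * x - Real.exp x) = Real.Gamma b := by
  have key := integral_image_eq_integral_abs_deriv_smul (s := univ) (f := Real.exp)
    (f' := Real.exp) MeasurableSet.univ (fun x _ => (Real.hasDerivAt_exp x).hasDerivWithinAt)
    Real.exp_injective.injOn (fun t : ℝ => Real.exp (-t) * t ^ (b - 1))
  rw [image_univ, Real.range_exp, ← Real.Gamma_eq_integral hb, setIntegral_univ] at key
  rw [key]
  refine integral_congr_ae (Eventually.of_forall fun x => ?_)
  simp only [abs_of_pos (Real.exp_pos x), smul_eq_mul]
  rw [← Real.exp_mul, ← Real.exp_add, ← Real.exp_add]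
  ring_nf

/-- The lines `±θ` can be moved to `±π`, where `e^s = -e^x` and Euler's integral gives `Γ(1 - c)`
times the phases `e^{±iπ(1-c)}`. Their difference is a sine, and the reflection formula finishes.
Convergence at `-∞` needs `c < 1`. -/
theorem lineDiff_exp_exp {θ c : ℝ} (h1 : Real.pi / 2 < θ) (h2 : θ < Real.pi) (hc : c < 1) :
    lineDiff θ (fun s => exp (exp s + ((1 - c : ℝ) : ℂ) * s)) =
      2 * Real.pi * I * (((Real.Gamma c)⁻¹ : ℝ) : ℂ) := by
  have hpi := Real.pi_pos
  have hb : 0 < 1 - c := by linarith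
  have hκ : 0 < -Real.cos θ :=
    neg_pos.2 (Real.cos_neg_of_pi_div_two_lt_of_lt h1 (by linarith))
  have hcos : ∀ y ∈ Icc θ Real.pi, Real.cos y ≤ - -Real.cos θ := fun y hy => by
    rw [neg_neg]; exact Real.cos_le_cos_of_nonneg_of_le_pi (by linarith) hy.2 hy.1
  have hA : ∀ ε : ℝ, ε = 1 ∨ ε = -1 →
      ∫ x : ℝ, exp (exp (x + (ε * Real.pi : ℝ) * I) + (1 - c : ℝ) * (x + (ε * Real.pi : ℝ) * I)) =
        exp (ε * (Real.pi * (1 - c)) * I) * Real.Gamma (1 - c) := by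
    intro ε hε
    have he : ∀ x : ℝ, exp (x + (ε * Real.pi : ℝ) * I) = -exp x := by
      intro x
      rcases hε with rfl | rfl <;> simp [exp_add, exp_neg]
    rw [← integral_exp_mul_sub_exp hb, ← integral_complex_ofReal, ← MeasureTheory.integral_const_mul]
    refine integral_congr_ae (Eventually.of_forall fun x => ?_)
    simp only [he]
    push_cast
    rw [← exp_add]
    ring_nf
  have e1 := integral_exp_exp_mul_eq hb h2.le hκ hcos
  have e2 := integral_exp_exp_mul_eq (α := -Real.pi) (β := -θ) hb (by linarith) hκ
    (fun y hy => by
      rw [← Real.cos_neg]; exact hcos _ ⟨by linarith [hy.2], by linarith [hy.1]⟩)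
  have a1 := hA 1 (Or.inl rfl)
  have a2 := hA (-1) (Or.inr rfl)
  simp only [one_mul, neg_one_mul, ofReal_one, ofReal_neg] at a1 a2 e1 e2
  have hrefl : Real.Gamma (1 - c) * Real.sin (Real.pi * (1 - c)) = Real.pi * (Real.Gamma c)⁻¹ := by
    have hG := Real.Gamma_mul_Gamma_one_sub c
    have hs : Real.sin (Real.pi * (1 - c)) = Real.sin (Real.pi * c) := by
      rw [mul_sub, mul_one, Real.sin_pi_sub]
    have hG0 : Real.Gamma (1 - c) ≠ 0 := (Real.Gamma_pos_of_pos hb).ne'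
    rw [hs]
    -- In inverted form the reflection formula is meaningful at the poles of `Γ(c)` too: there both
    -- `(Γ c)⁻¹` and the sine are zero.
    have := congrArg (fun z => z⁻¹) hG
    simp only [mul_inv, inv_div] at this
    field_simp at this
    rw [mul_comm c] at this
    rw [← this, div_eq_mul_inv]
  rw [lineDiff]
  simp only [ofReal_neg]
  rw [e1, ← e2, a1, a2]
  have hsin : exp (Real.pi * (1 - c) * I) - exp (-(Real.pi * (1 - c)) * I) =
      2 * I * (Real.sin (Real.pi * (1 - c)) : ℝ) := by
    push_cast
    rw [Complex.sin]
    linear_combination (exp (Real.pi * (1 - c) * I) - exp (-(Real.pi * (1 - c)) * I)) * I_sq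
  have hr := congrArg (fun r : ℝ => (r : ℂ)) hrefl
  push_cast at hr hsin ⊢
  linear_combination ((Real.Gamma (1 - c) : ℝ) : ℂ) * hsin + 2 * I * hr

theorem hankelIntegral_exp_exp_of_lt_one {θ c : ℝ} (x₀ : ℝ) (h1 : Real.pi / 2 < θ)
    (h2 : θ < Real.pi) (hc : c < 1) :
    hankelIntegral θ x₀ (fun s => exp (exp s + ((1 - c : ℝ) : ℂ) * s)) =
      2 * Real.pi * I * (((Real.Gamma c)⁻¹ : ℝ) : ℂ) := by
  have hpi := Real.pi_pos
  have hb : 0 < 1 - c := by linarith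
  have hκ : Real.cos θ < 0 := Real.cos_neg_of_pi_div_two_lt_of_lt h1 (by linarith)
  have i1 := integrable_exp_exp_mul hb hκ
  have i2 := integrable_exp_exp_mul (ϕ := -θ) hb (by rwa [Real.cos_neg])
  rw [← lineDiff_exp_exp h1 h2 hc, ← add_zero (lineDiff _ _)]
  refine hankelIntegral_eq_lineDiff (C := Real.exp 1) (x₂ := 0) (by linarith) hb i1 i2
    (fun s hs _ => ?_) ?_
  · rw [norm_exp, ← Real.exp_add, Real.exp_le_exp]
    have h3 : (exp s).re ≤ 1 := (re_le_norm _).trans (by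
      rw [norm_exp]; exact Real.exp_le_one_iff.2 hs)
    simp only [add_re, mul_re, ofReal_re, ofReal_im, zero_mul, sub_zero]
    linarith
  · filter_upwards [eventually_le_atBot x₀] with x₁ hx
    rw [hankelIntegral_sub_eq_rectIntegral hx i1.integrableOn i2.integrableOn,
      rectIntegral_eq_zero hx (by linarith) (fun s _ _ _ => by fun_prop)]

theorem integrableOn_exp_exp_mul {ϕ : ℝ} (b x₀ : ℝ) (hϕ : Real.cos ϕ < 0) :
    IntegrableOn (fun x : ℝ => exp (exp (x + ϕ * I) + b * (x + ϕ * I))) (Ioi x₀) := by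
  refine Integrable.mono' (integrableOn_exp_neg_mul_exp_Ioi (neg_pos.2 hϕ) b x₀)
    (Continuous.aestronglyMeasurable (by fun_prop)) (Eventually.of_forall fun x => ?_)
  rw [norm_exp_exp_mul, neg_neg]

/-- At `c = 1` the integrand no longer decays at `-∞`, and the recurrence from `c = 0` only says `0
= 0`. The value is the limit from `c < 1`, since the path starting at `x₀` depends continuously on
`c`. -/
theorem hankelIntegral_exp_exp_one {θ : ℝ} (x₀ : ℝ) (h1 : Real.pi / 2 < θ) (h2 : θ < Real.pi) :
    hankelIntegral θ x₀ (fun s => exp (exp s + ((1 - 1 : ℝ) : ℂ) * s)) =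
      2 * Real.pi * I * (((Real.Gamma 1)⁻¹ : ℝ) : ℂ) := by
  have hpi := Real.pi_pos
  have hκ : Real.cos θ < 0 := Real.cos_neg_of_pi_div_two_lt_of_lt h1 (by linarith)
  have ray : ∀ ϕ : ℝ, Real.cos ϕ < 0 → ContinuousAt (fun c : ℝ => ∫ x in Ioi x₀,
      exp (exp (x + ϕ * I) + ((1 - c : ℝ) : ℂ) * (x + ϕ * I))) 1 := by
    intro ϕ hϕ
    -- For `0 ≤ c ≤ 2` one has `(1 - c) x ≤ |x|`; the two summands cover `x ≥ 0` and `x ≤ 0`.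
    refine continuousAt_of_dominated (bound := fun x =>
      Real.exp (- -Real.cos ϕ * Real.exp x + 1 * x)
        + Real.exp (- -Real.cos ϕ * Real.exp x + (-1) * x)) ?_ ?_ ?_ ?_
    · exact Eventually.of_forall fun c => Continuous.aestronglyMeasurable (by fun_prop)
    · filter_upwards [Icc_mem_nhds (show (0 : ℝ) < 1 by norm_num) (show (1 : ℝ) < 2 by norm_num)]
        with c hc
      refine Eventually.of_forall fun x => ?_
      rw [norm_exp_exp_mul, neg_neg]
      rcases le_total 0 x with hx | hx
      · refine le_add_of_le_of_nonneg (Real.exp_le_exp.2 ?_) (Real.exp_pos _).le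
        nlinarith [hc.1, hc.2]
      · refine le_add_of_nonneg_of_le (Real.exp_pos _).le (Real.exp_le_exp.2 ?_)
        nlinarith [hc.1, hc.2]
    · exact (integrableOn_exp_neg_mul_exp_Ioi (neg_pos.2 hϕ) 1 x₀).add
        (integrableOn_exp_neg_mul_exp_Ioi (neg_pos.2 hϕ) (-1) x₀)
    · exact Eventually.of_forall fun x => by fun_prop
  have seg : Continuous (fun c : ℝ => ∫ y in (-θ)..θ,
      exp (exp (x₀ + y * I) + ((1 - c : ℝ) : ℂ) * (x₀ + y * I))) :=
    continuous_parametric_intervalIntegral_of_continuous' (by fun_prop) _ _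
  have hL : ContinuousAt (fun c : ℝ =>
      hankelIntegral θ x₀ (fun s => exp (exp s + ((1 - c : ℝ) : ℂ) * s))) 1 :=
    ((seg.continuousAt.const_mul I).add (ray θ hκ)).sub (ray (-θ) (by rwa [Real.cos_neg]))
  have hR : ContinuousAt (fun c : ℝ => 2 * Real.pi * I * (((Real.Gamma c)⁻¹ : ℝ) : ℂ)) 1 := by
    have : ContinuousAt (fun c : ℝ => (Real.Gamma c)⁻¹) 1 :=
      ((Real.differentiableOn_Gamma_Ioi.differentiableAt (Ioi_mem_nhds one_pos)).continuousAt).inv₀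
        (by simp)
    exact continuousAt_const.mul (continuous_ofReal.continuousAt.comp this)
  refine tendsto_nhds_unique (hL.mono_left nhdsWithin_le_nhds : Tendsto _ (𝓝[<] (1 : ℝ)) _)
    ((hR.mono_left nhdsWithin_le_nhds : Tendsto _ (𝓝[<] (1 : ℝ)) _).congr' ?_)
  filter_upwards [self_mem_nhdsWithin] with c hc
  exact (hankelIntegral_exp_exp_of_lt_one x₀ h1 h2 hc).symm

/-- Integration by parts, mirroring `Γ(c + 1) = c Γ(c)`: the derivative of `exp (e^s - c s)`
integrates to zero along the path, as its corner values cancel and it vanishes at both ends. -/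
theorem hankelIntegral_exp_exp_add_one {θ : ℝ} (c x₀ : ℝ) (h1 : Real.pi / 2 < θ)
    (h2 : θ < Real.pi) :
    hankelIntegral θ x₀ (fun s => exp (exp s + ((1 - c : ℝ) : ℂ) * s)) =
      c * hankelIntegral θ x₀ (fun s => exp (exp s + ((1 - (c + 1) : ℝ) : ℂ) * s)) := by
  have hκ : Real.cos θ < 0 := Real.cos_neg_of_pi_div_two_lt_of_lt h1 (by linarith [Real.pi_pos])
  set P : ℂ → ℂ := fun s => exp (exp s + ((1 - (c + 1) : ℝ) : ℂ) * s) with hP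
  set Q : ℂ → ℂ := fun s => exp (exp s + ((1 - c : ℝ) : ℂ) * s) with hQ
  have hd : ∀ s, HasDerivAt P (Q s - c * P s) s := by
    intro s
    refine (((hasDerivAt_exp s).add ((hasDerivAt_id s).const_mul
      ((1 - (c + 1) : ℝ) : ℂ))).cexp).congr_deriv ?_
    have : Q s = P s * exp s := by
      simp only [hP, hQ, ← exp_add]; push_cast; ring_nf
    rw [this]
    simp only [hP, id, Pi.add_apply]; push_cast; ring
  have hcP : Continuous P := by fun_prop
  have hcQ : Continuous Q := by fun_prop
  have ray : ∀ ϕ : ℝ, Real.cos ϕ < 0 → (∫ x in Ioi x₀, Q (x + ϕ * I))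
      - c * (∫ x in Ioi x₀, P (x + ϕ * I)) = - P (x₀ + ϕ * I) := by
    intro ϕ hϕ
    have iQ : IntegrableOn (fun x : ℝ => Q (x + ϕ * I)) (Ioi x₀) :=
      integrableOn_exp_exp_mul (1 - c) x₀ hϕ
    have iP : IntegrableOn (fun x : ℝ => P (x + ϕ * I)) (Ioi x₀) :=
      integrableOn_exp_exp_mul (1 - (c + 1)) x₀ hϕ
    rw [← MeasureTheory.integral_const_mul, ← integral_sub iQ (iP.const_mul _), ← zero_sub]
    refine integral_Ioi_of_hasDerivAt_of_tendsto' (f := fun x : ℝ => P (x + ϕ * I))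
      (fun x _ => ?_) (iQ.sub (iP.const_mul _)) ?_
    · have : HasDerivAt (fun x : ℝ => (x : ℂ) + ϕ * I) 1 x :=
        ((hasDerivAt_id x).ofReal_comp).add_const _
      exact ((hd _).comp x this).congr_deriv (mul_one _)
    · refine squeeze_zero_norm (a := fun x =>
        (Real.exp x) ^ (1 - (c + 1)) * Real.exp (- -Real.cos ϕ * Real.exp x)) (fun x => ?_)
        ((tendsto_rpow_mul_exp_neg_mul_atTop_nhds_zero _ _ (neg_pos.2 hϕ)).comp
          Real.tendsto_exp_atTop)
      simp only [hP]
      rw [norm_exp_exp_mul, ← Real.exp_mul, ← Real.exp_add, Real.exp_le_exp]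
      linarith
  have seg : I * (∫ y in (-θ)..θ, Q (x₀ + y * I)) - c * (I * (∫ y in (-θ)..θ, P (x₀ + y * I))) =
      P (x₀ + θ * I) - P (x₀ + (-θ : ℝ) * I) := by
    have := integral_eq_sub_of_hasDerivAt (a := -θ) (b := θ) (f := fun y : ℝ => P (x₀ + y * I))
      (f' := fun y : ℝ => I * Q (x₀ + y * I) - c * (I * P (x₀ + y * I))) (fun y _ => by
        have h : HasDerivAt (fun y : ℝ => (x₀ : ℂ) + y * I) (1 * I) y :=
          ((hasDerivAt_id y).ofReal_comp.mul_const I).const_add _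
        exact ((hd _).comp y h).congr_deriv (by ring)) (by
        exact Continuous.intervalIntegrable (by fun_prop) _ _)
    rw [← this, intervalIntegral.integral_sub (Continuous.intervalIntegrable (by fun_prop) _ _)
      (Continuous.intervalIntegrable (by fun_prop) _ _)]
    simp only [intervalIntegral.integral_const_mul]
  have r1 := ray θ hκ
  have r2 := ray (-θ) (by rwa [Real.cos_neg])
  simp only [hankelIntegral]
  linear_combination seg + r1 - r2

/-- **Hankel's formula** for the reciprocal Gamma function at real arguments. -/
theorem hankelIntegral_exp_exp {θ : ℝ} (c x₀ : ℝ) (h1 : Real.pi / 2 < θ) (h2 : θ < Real.pi) :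
    hankelIntegral θ x₀ (fun s => exp (exp s + ((1 - c : ℝ) : ℂ) * s)) =
      2 * Real.pi * I * (((Real.Gamma c)⁻¹ : ℝ) : ℂ) := by
  -- Induction on an integer bound for `c`; starting from `c ≤ 1` keeps the factor `c - 1` in the
  -- recurrence nonzero.
  suffices H : ∀ (n : ℕ) (c : ℝ), c ≤ n + 1 →
      hankelIntegral θ x₀ (fun s => exp (exp s + ((1 - c : ℝ) : ℂ) * s)) =
        2 * Real.pi * I * (((Real.Gamma c)⁻¹ : ℝ) : ℂ) by
    obtain ⟨n, hn⟩ := exists_nat_ge c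
    exact H n c (by linarith)
  intro n
  induction n with
  | zero =>
    intro c hc
    rcases (show c ≤ 1 by simpa using hc).lt_or_eq with h | rfl
    · exact hankelIntegral_exp_exp_of_lt_one x₀ h1 h2 h
    · exact hankelIntegral_exp_exp_one x₀ h1 h2
  | succ n ih =>
    intro c hc
    rcases le_or_gt c 1 with h | h
    · exact ih c (h.trans (by simp))
    · have hc0 : c - 1 ≠ 0 := by linarith
      have e := hankelIntegral_exp_exp_add_one (c - 1) x₀ h1 h2
      rw [ih (c - 1) (by push_cast at hc; linarith), sub_add_cancel] at e
      have hG : Real.Gamma c = (c - 1) * Real.Gamma (c - 1) := by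
        simpa using Real.Gamma_add_one hc0
      have hc0' : ((c - 1 : ℝ) : ℂ) ≠ 0 := ofReal_ne_zero.2 hc0
      refine mul_left_cancel₀ hc0' ?_
      rw [← e, hG, mul_inv]
      push_cast at hc0' ⊢
      field_simp

/-! ### The contour formula for `E_{p,p}`. -/

theorem hasSum_integral_mul_pow {α : Type*} [MeasurableSpace α] {μ : Measure α} {g b : α → ℂ}
    {r : ℝ} (hr : r < 1) (hg : Integrable g μ) (hb : AEStronglyMeasurable b μ)
    (hbr : ∀ᵐ x ∂μ, ‖b x‖ ≤ r) :
    HasSum (fun k : ℕ => ∫ x, g x * b x ^ k ∂μ) (∫ x, g x / (1 - b x) ∂μ) := by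
  rcases eq_or_ne μ 0 with rfl | hμ
  · simp [hasSum_zero]
  have hr0 : 0 ≤ r := by
    have : NeBot (ae μ) := ae_neBot.2 hμ
    obtain ⟨x, hx⟩ := hbr.exists
    exact (norm_nonneg _).trans hx
  have hle : ∀ k : ℕ, ∀ᵐ x ∂μ, ‖g x * b x ^ k‖ ≤ ‖g x‖ * r ^ k := fun k => by
    filter_upwards [hbr] with x hx
    rw [norm_mul, norm_pow]
    gcongr
  have hint : ∀ k : ℕ, Integrable (fun x => g x * b x ^ k) μ := fun k =>
    (hg.norm.mul_const (r ^ k)).mono' (hg.aestronglyMeasurable.mul (hb.pow k)) (hle k)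
  have key := hasSum_integral_of_summable_integral_norm hint (by
    refine Summable.of_nonneg_of_le (fun k => integral_nonneg fun x => norm_nonneg _) (fun k => ?_)
      ((summable_geometric_of_lt_one hr0 hr).mul_left (∫ x, ‖g x‖ ∂μ))
    rw [← MeasureTheory.integral_mul_const]
    exact integral_mono_ae (hint k).norm (hg.norm.mul_const _) (hle k))
  convert! key using 1
  refine MeasureTheory.integral_congr_ae ?_
  filter_upwards [hbr] with x hx
  rw [tsum_mul_left, tsum_geometric_of_norm_lt_one (hx.trans_lt hr), div_eq_mul_inv]

/-- The integrand `e^u / (u^p - w) du` in the coordinate `u = e^s`. -/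
noncomputable def mittagLefflerKernel (p : ℝ) (w s : ℂ) : ℂ :=
  exp (exp s + s) / (exp (p * s) - w)

/-- The scalar Mittag-Leffler function `E_{p,p}`. -/
noncomputable def scalarMittagLeffler (p : ℝ) (w : ℂ) : ℂ :=
  ∑' k : ℕ, (((Real.Gamma (p * k + p))⁻¹ : ℝ) : ℂ) * w ^ k

/-- The path stays in `Re s ≥ x₀`, where `|w e^{-ps}| ≤ r < 1`. So the geometric series for `1 / (1
- w e^{-ps})` may be integrated termwise, and Hankel's formula with `c = pk + p` evaluates each
term. -/
theorem hasSum_hankelIntegral_kernel {p θ x₀ : ℝ} {w : ℂ} (h1 : Real.pi / 2 < θ)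
    (h2 : θ < Real.pi) (hp : 0 < p) (hx₀ : ‖w‖ < Real.exp (p * x₀)) :
    HasSum (fun k : ℕ => (((Real.Gamma (p * k + p))⁻¹ : ℝ) : ℂ) * w ^ k)
      ((2 * Real.pi * I)⁻¹ * hankelIntegral θ x₀ (mittagLefflerKernel p w)) := by
  have hκ : Real.cos θ < 0 := Real.cos_neg_of_pi_div_two_lt_of_lt h1 (by linarith [Real.pi_pos])
  set g : ℂ → ℂ := fun s => exp (exp s + ((1 - p : ℝ) : ℂ) * s) with hg
  set b : ℂ → ℂ := fun s => w * exp (-(p * s)) with hb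
  set r : ℝ := ‖w‖ * Real.exp (-(p * x₀)) with hr
  have hr1 : r < 1 := by
    rw [hr, Real.exp_neg, ← div_eq_mul_inv, div_lt_one (Real.exp_pos _)]; exact hx₀
  have hbr : ∀ s : ℂ, x₀ ≤ s.re → ‖b s‖ ≤ r := fun s hs => by
    rw [hb, hr]
    simp only [norm_mul, norm_exp, neg_re, mul_re, ofReal_re, ofReal_im, zero_mul, sub_zero]
    gcongr
  have hgb : ∀ s : ℂ, g s / (1 - b s) = mittagLefflerKernel p w s := fun s => by
    have e1 : g s = exp (exp s + s) * exp (-(p * s)) := by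
      simp only [hg, ← exp_add]; push_cast; ring_nf
    have e2 : 1 - b s = (exp (p * s) - w) * exp (-(p * s)) := by
      rw [sub_mul, ← exp_add, add_neg_cancel, exp_zero]
    rw [e1, e2, mul_div_mul_right _ _ (exp_ne_zero _), mittagLefflerKernel]
  have hgk : ∀ (k : ℕ) (s : ℂ), g s * b s ^ k =
      w ^ k * exp (exp s + ((1 - (p * k + p) : ℝ) : ℂ) * s) := fun k s => by
    simp only [hg, hb]
    rw [mul_pow, ← exp_nat_mul, mul_left_comm, ← exp_add]
    push_cast; ring_nf
  have hgc : Continuous g := by fun_prop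
  have hbc : Continuous b := by fun_prop
  have ray : ∀ ϕ : ℝ, Real.cos ϕ < 0 → HasSum
      (fun k : ℕ => ∫ x in Ioi x₀, g (x + ϕ * I) * b (x + ϕ * I) ^ k)
      (∫ x in Ioi x₀, g (x + ϕ * I) / (1 - b (x + ϕ * I))) := fun ϕ hϕ =>
    hasSum_integral_mul_pow (g := fun x : ℝ => g (x + ϕ * I)) (b := fun x : ℝ => b (x + ϕ * I))
      hr1 (integrableOn_exp_exp_mul (1 - p) x₀ hϕ)
      (Continuous.aestronglyMeasurable (by fun_prop)) <| by
      filter_upwards [ae_restrict_mem measurableSet_Ioi] with x hx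
      exact hbr _ (by simpa using (mem_Ioi.1 hx).le)
  have seg : HasSum (fun k : ℕ => ∫ y in (-θ)..θ, g (x₀ + y * I) * b (x₀ + y * I) ^ k)
      (∫ y in (-θ)..θ, g (x₀ + y * I) / (1 - b (x₀ + y * I))) := by
    simp only [integral_of_le (show -θ ≤ θ by linarith [Real.pi_pos])]
    refine hasSum_integral_mul_pow (g := fun y : ℝ => g (x₀ + y * I))
      (b := fun y : ℝ => b (x₀ + y * I)) hr1 ?_ (Continuous.aestronglyMeasurable (by fun_prop))
      (Eventually.of_forall fun y => hbr _ (by simp))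
    exact (Continuous.integrableOn_Icc (by fun_prop)).mono_set Ioc_subset_Icc_self
  have tot := (((seg.mul_left I).add (ray θ hκ)).sub
    (ray (-θ) (by rwa [Real.cos_neg]))).mul_left (2 * Real.pi * I)⁻¹
  simp only [hgb, hgk, MeasureTheory.integral_const_mul, intervalIntegral.integral_const_mul] at tot
  convert! tot using 1
  funext k
  have hk := hankelIntegral_exp_exp (p * k + p) x₀ h1 h2
  rw [hankelIntegral] at hk
  have h2pi : (2 * Real.pi * I : ℂ) ≠ 0 := two_pi_I_ne_zero
  rw [eq_inv_mul_iff_mul_eq₀ h2pi]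
  linear_combination (-w ^ k) * hk

theorem summable_scalarMittagLeffler {p : ℝ} (hp : 0 < p) (w : ℂ) :
    Summable fun k : ℕ => (((Real.Gamma (p * k + p))⁻¹ : ℝ) : ℂ) * w ^ k := by
  have hpi := Real.pi_pos
  refine (hasSum_hankelIntegral_kernel (θ := 3 * Real.pi / 4)
    (x₀ := ‖w‖ / p) (by linarith) (by linarith) hp ?_).summable
  rw [mul_div_cancel₀ _ hp.ne']
  exact (Real.add_one_le_exp ‖w‖).trans_lt' (lt_add_one _)

/-! ### Shrinking the contour and collecting the residue. -/

theorem rectIntegral_add {θ x₁ x₀ : ℝ} {s₀ : ℂ} {F G H : ℂ → ℂ} (h₁ : x₁ < s₀.re)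
    (h₀ : s₀.re < x₀) (hs : |s₀.im| < θ)
    (hF : ∀ s : ℂ, |s.im| ≤ θ → s ≠ s₀ → ContinuousAt F s)
    (hG : ∀ s : ℂ, |s.im| ≤ θ → s ≠ s₀ → ContinuousAt G s)
    (hH : ∀ s : ℂ, |s.im| ≤ θ → s ≠ s₀ → H s = F s + G s) :
    rectIntegral θ x₁ x₀ H = rectIntegral θ x₁ x₀ F + rectIntegral θ x₁ x₀ G := by
  obtain ⟨hs1, hs2⟩ := abs_lt.1 hs
  have hor : ∀ ϕ : ℝ, |ϕ| = θ → ∫ x in x₁..x₀, H (x + ϕ * I) =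
      (∫ x in x₁..x₀, F (x + ϕ * I)) + ∫ x in x₁..x₀, G (x + ϕ * I) := by
    intro ϕ hϕ
    have a : ∀ x : ℝ, |((x : ℂ) + ϕ * I).im| ≤ θ := fun x => by simp [hϕ]
    have b : ∀ x : ℝ, (x : ℂ) + ϕ * I ≠ s₀ := fun x h => by
      rw [← h] at hs; simp [hϕ] at hs
    rw [← intervalIntegral.integral_add]
    · exact integral_congr fun x _ => hH _ (a x) (b x)
    · exact Continuous.intervalIntegrable (continuous_iff_continuousAt.2 fun x =>
        ContinuousAt.comp (f := fun x : ℝ => (x : ℂ) + ϕ * I) (hF _ (a x) (b x)) (by fun_prop)) _ _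
    · exact Continuous.intervalIntegrable (continuous_iff_continuousAt.2 fun x =>
        ContinuousAt.comp (f := fun x : ℝ => (x : ℂ) + ϕ * I) (hG _ (a x) (b x)) (by fun_prop)) _ _
  have ver : ∀ x : ℝ, x ≠ s₀.re → ∫ y in (-θ)..θ, H (x + y * I) =
      (∫ y in (-θ)..θ, F (x + y * I)) + ∫ y in (-θ)..θ, G (x + y * I) := by
    intro x hx
    have a : ∀ y ∈ uIcc (-θ) θ, |((x : ℂ) + y * I).im| ≤ θ := fun y hy => by
      rw [uIcc_of_le (by linarith)] at hy
      simpa using abs_le.2 hy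
    have b : ∀ y : ℝ, (x : ℂ) + y * I ≠ s₀ := fun y h => hx (by rw [← h]; simp)
    rw [← intervalIntegral.integral_add]
    · exact integral_congr fun y hy => hH _ (a y hy) (b y)
    · exact ContinuousOn.intervalIntegrable fun y hy => ContinuousAt.continuousWithinAt <|
        ContinuousAt.comp (f := fun y : ℝ => (x : ℂ) + y * I) (hF _ (a y hy) (b y)) (by fun_prop)
    · exact ContinuousOn.intervalIntegrable fun y hy => ContinuousAt.continuousWithinAt <|
        ContinuousAt.comp (f := fun y : ℝ => (x : ℂ) + y * I) (hG _ (a y hy) (b y)) (by fun_prop)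
  have hθ : 0 ≤ θ := by linarith
  simp only [rectIntegral]
  rw [hor θ (abs_of_nonneg hθ), hor (-θ) (by rw [abs_neg, abs_of_nonneg hθ]), ver x₀ h₀.ne',
    ver x₁ h₁.ne]
  ring

theorem rectIntegral_const_mul (θ x₁ x₀ : ℝ) (c : ℂ) (F : ℂ → ℂ) :
    rectIntegral θ x₁ x₀ (fun s => c * F s) = c * rectIntegral θ x₁ x₀ F := by
  simp only [rectIntegral, intervalIntegral.integral_const_mul]
  ring

/-- For `|a| ≤ 1` the function `x ↦ Re x - a ‖x‖` is 2-Lipschitz, and it vanishes at `v`. With `a =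
cos (pθ)` it measures how far `w` is from the rays `arg = ±pθ`. -/
theorem mul_norm_le_norm_sub_of_re_eq {a κ : ℝ} {v w : ℂ} (ha : |a| ≤ 1) (hv : v.re = ‖v‖ * a)
    (h : 2 * κ * ‖w‖ ≤ |w.re - ‖w‖ * a|) : κ * ‖w‖ ≤ ‖v - w‖ := by
  have e : w.re - ‖w‖ * a = -(v - w).re + (‖v‖ - ‖w‖) * a := by
    rw [sub_re, hv]; ring
  have h1 := abs_re_le_norm (v - w)
  have h2 : |(‖v‖ - ‖w‖) * a| ≤ ‖v - w‖ := by
    rw [abs_mul]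
    nlinarith [abs_norm_sub_norm_le v w, abs_nonneg a, abs_nonneg (‖v‖ - ‖w‖)]
  have h3 := abs_add_le (-(v - w).re) ((‖v‖ - ‖w‖) * a)
  rw [abs_neg] at h3
  rw [e] at h
  linarith

theorem mul_norm_le_norm_exp_sub {p θ κ ϕ : ℝ} {w : ℂ} (hϕ : ϕ = θ ∨ ϕ = -θ)
    (h : 2 * κ * ‖w‖ ≤ |w.re - ‖w‖ * Real.cos (p * θ)|) (x : ℝ) :
    κ * ‖w‖ ≤ ‖exp (p * (x + ϕ * I)) - w‖ := by
  refine mul_norm_le_norm_sub_of_re_eq (Real.abs_cos_le_one _) ?_ h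
  rw [norm_exp, exp_re]
  rcases hϕ with rfl | rfl <;> simp

theorem norm_mittagLefflerKernel_mul_le {p θ κ ϕ : ℝ} (a : ℝ) {w : ℂ} (hϕ : ϕ = θ ∨ ϕ = -θ)
    (hw : w ≠ 0) (hκ : 0 < κ)
    (h : 2 * κ * ‖w‖ ≤ |w.re - ‖w‖ * Real.cos (p * θ)|) (x : ℝ) :
    ‖exp (exp (x + ϕ * I) + a * (x + ϕ * I)) / (exp (p * (x + ϕ * I)) - w)‖ ≤
      Real.exp (- -Real.cos θ * Real.exp x + a * x) * (κ * ‖w‖)⁻¹ := by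
  have h0 : 0 < κ * ‖w‖ := mul_pos hκ (norm_pos_iff.2 hw)
  have h1 := mul_norm_le_norm_exp_sub hϕ h x
  have hc : Real.cos ϕ = Real.cos θ := by rcases hϕ with rfl | rfl <;> simp
  rw [norm_div, norm_exp_exp_mul, neg_neg, hc, div_eq_mul_inv]
  gcongr

theorem integrable_exp_exp_mul_div {p θ κ ϕ a : ℝ} {w : ℂ} (hϕ : ϕ = θ ∨ ϕ = -θ) (ha : 0 < a)
    (hw : w ≠ 0) (hκ : 0 < κ) (hθ : Real.cos θ < 0)
    (h : 2 * κ * ‖w‖ ≤ |w.re - ‖w‖ * Real.cos (p * θ)|) :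
    Integrable fun x : ℝ =>
      exp (exp (x + ϕ * I) + a * (x + ϕ * I)) / (exp (p * (x + ϕ * I)) - w) := by
  refine Integrable.mono' ((integrable_exp_neg_mul_exp (neg_pos.2 hθ) ha).mul_const (κ * ‖w‖)⁻¹)
    (Continuous.aestronglyMeasurable ?_)
    (Eventually.of_forall (norm_mittagLefflerKernel_mul_le a hϕ hw hκ h))
  refine Continuous.div (by fun_prop) (by fun_prop) fun x hx => ?_
  have h1 := mul_norm_le_norm_exp_sub hϕ h x
  rw [hx, norm_zero] at h1
  exact absurd (mul_pos hκ (norm_pos_iff.2 hw)) (not_lt.2 h1)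

/-- Common part of the stable and the unstable case; `R` stands for the contribution of the poles in
the strip. -/
theorem scalarMittagLeffler_eq_lineDiff_add {p θ κ : ℝ} {w R : ℂ} (h1 : Real.pi / 2 < θ)
    (h2 : θ < Real.pi) (hp : 0 < p) (hw : w ≠ 0) (hκ : 0 < κ)
    (h : 2 * κ * ‖w‖ ≤ |w.re - ‖w‖ * Real.cos (p * θ)|)
    (hR : ∀ x₀ : ℝ, ‖w‖ < Real.exp (p * x₀) →
      ∀ᶠ x₁ in atBot, rectIntegral θ x₁ x₀ (mittagLefflerKernel p w) = R) :
    scalarMittagLeffler p w =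
      (2 * Real.pi * I)⁻¹ * (lineDiff θ (mittagLefflerKernel p w) + R) := by
  have hθ : Real.cos θ < 0 := Real.cos_neg_of_pi_div_two_lt_of_lt h1 (by linarith [Real.pi_pos])
  have hw' := norm_pos_iff.2 hw
  have int : ∀ ϕ : ℝ, ϕ = θ ∨ ϕ = -θ →
      Integrable fun x : ℝ => mittagLefflerKernel p w (x + ϕ * I) := fun ϕ hϕ => by
    simpa [mittagLefflerKernel] using integrable_exp_exp_mul_div hϕ one_pos hw hκ hθ h
  have i1 := int θ (Or.inl rfl)
  have i2 := int (-θ) (Or.inr rfl)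
  obtain ⟨x₀, hx₀⟩ : ∃ x₀ : ℝ, ‖w‖ < Real.exp (p * x₀) := ⟨‖w‖ / p, by
    rw [mul_div_cancel₀ _ hp.ne']
    exact (Real.add_one_le_exp ‖w‖).trans_lt' (lt_add_one _)⟩
  rw [scalarMittagLeffler, (hasSum_hankelIntegral_kernel h1 h2 hp hx₀).tsum_eq]
  congr 1
  -- Left of `x₂` one has `|e^{ps}| ≤ ‖w‖/2`, so the denominator is at least `‖w‖/2`, and `|e^s| ≤
  -- 1` bounds the double exponential by `e`.
  refine hankelIntegral_eq_lineDiff (a := 1) (C := Real.exp 1 * (‖w‖ / 2)⁻¹)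
    (x₂ := min 0 (Real.log (‖w‖ / 2) / p)) (by linarith [Real.pi_pos]) one_pos i1 i2
    (fun s hs _ => ?_) ?_
  · obtain ⟨hs0, hs1⟩ := le_min_iff.1 hs
    rw [le_div_iff₀ hp, mul_comm] at hs1
    have hs2 : Real.exp (p * s.re) ≤ ‖w‖ / 2 :=
      (Real.exp_le_exp.2 hs1).trans_eq (Real.exp_log (by positivity))
    have hden : ‖w‖ / 2 ≤ ‖exp (p * s) - w‖ := by
      have := norm_sub_norm_le w (exp (p * s))
      rw [norm_sub_rev, norm_exp] at this
      simp only [mul_re, ofReal_re, ofReal_im, zero_mul, sub_zero] at this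
      linarith
    have hnum : ‖exp (exp s + s)‖ ≤ Real.exp 1 * Real.exp (1 * s.re) := by
      rw [norm_exp, ← Real.exp_add, Real.exp_le_exp, add_re, one_mul]
      have h3 : (exp s).re ≤ 1 := (re_le_norm _).trans (by
        rw [norm_exp]; exact Real.exp_le_one_iff.2 hs0)
      linarith
    rw [mittagLefflerKernel, norm_div, div_eq_mul_inv, mul_right_comm]
    gcongr
  · filter_upwards [eventually_le_atBot x₀, hR x₀ hx₀] with x₁ hx hx'
    rw [hankelIntegral_sub_eq_rectIntegral hx i1.integrableOn i2.integrableOn, hx']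

theorem scalarMittagLeffler_eq_of_stable {p θ κ : ℝ} {w : ℂ} (h1 : Real.pi / 2 < θ)
    (h2 : θ < Real.pi) (hp : 0 < p) (hp1 : p < 1) (hw : w ≠ 0) (hκ : 0 < κ)
    (h : w.re - ‖w‖ * Real.cos (p * θ) ≤ -(2 * κ * ‖w‖)) :
    scalarMittagLeffler p w = (2 * Real.pi * I)⁻¹ * lineDiff θ (mittagLefflerKernel p w) := by
  have hpi := Real.pi_pos
  have hw' := norm_pos_iff.2 hw
  have hκw : 0 < 2 * κ * ‖w‖ := by positivity
  rw [scalarMittagLeffler_eq_lineDiff_add (R := 0) h1 h2 hp hw hκ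
    ((le_neg.1 h).trans (neg_le_abs _)), add_zero]
  intro x₀ _
  filter_upwards [eventually_le_atBot x₀] with x₁ hx
  refine rectIntegral_eq_zero hx (by linarith) fun s _ _ hs => ?_
  unfold mittagLefflerKernel
  refine DifferentiableAt.div (by fun_prop) (by fun_prop) fun h0 => ?_
  have hws : w = exp (p * s) := (sub_eq_zero.1 h0).symm
  -- A zero of the denominator in the strip would force `|arg w| ≤ pθ`, against the cone condition.
  have hre : w.re = ‖w‖ * Real.cos (p * |s.im|) := by
    rw [hws, norm_exp, exp_re, ← Real.cos_abs]
    simp [abs_mul, abs_of_pos hp]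
  have : Real.cos (p * θ) ≤ Real.cos (p * |s.im|) :=
    Real.cos_le_cos_of_nonneg_of_le_pi (by positivity) (by nlinarith) (by gcongr)
  nlinarith

theorem scalarMittagLeffler_eq_of_unstable {p θ κ : ℝ} {w : ℂ} (h1 : Real.pi / 2 < θ)
    (h2 : θ < Real.pi) (hp : 0 < p) (hp1 : p < 1) (hw : w ≠ 0) (hκ : 0 < κ)
    (h : 2 * κ * ‖w‖ ≤ w.re - ‖w‖ * Real.cos (p * θ)) :
    scalarMittagLeffler p w = (2 * Real.pi * I)⁻¹ * lineDiff θ (mittagLefflerKernel p w) +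
      exp (exp (log w / p) + log w / p) / (p * w) := by
  have hpi := Real.pi_pos
  have hw' := norm_pos_iff.2 hw
  have hκw : 0 < 2 * κ * ‖w‖ := by positivity
  have hpc : (p : ℂ) ≠ 0 := ofReal_ne_zero.2 hp.ne'
  set s₀ : ℂ := log w / p with hs₀
  have hexp : exp (p * s₀) = w := by rw [hs₀, mul_div_cancel₀ _ hpc, exp_log hw]
  have him : s₀.im = arg w / p := by rw [hs₀, div_ofReal_im, log_im]
  have hre : s₀.re = Real.log ‖w‖ / p := by rw [hs₀, div_ofReal_re, log_re]
  have him' : |s₀.im| < θ := by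
    rw [him, abs_div, abs_of_pos hp, div_lt_iff₀ hp, mul_comm]
    by_contra! hcon
    have hc := Real.cos_le_cos_of_nonneg_of_le_pi (by nlinarith) (abs_arg_le_pi w) hcon
    rw [Real.cos_abs] at hc
    have := norm_mul_cos_arg w
    nlinarith
  set D : ℂ → ℂ := fun s => exp (p * s) - w with hD
  have hDd : Differentiable ℂ D := by fun_prop
  have hD0 : D s₀ = 0 := sub_eq_zero.2 hexp
  -- The zeros are spaced by `2πi/p`, and `2π/p` exceeds the height `2π` of the strip because `p <
  -- 1`.
  have hDs : ∀ s : ℂ, |s.im| < Real.pi → s ≠ s₀ → D s ≠ 0 := by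
    intro s hs hne h0
    have he : exp (p * s) = exp (p * s₀) := by rw [hexp]; exact sub_eq_zero.1 h0
    obtain ⟨n, hn⟩ := exp_eq_exp_iff_exists_int.1 he
    have hi := congrArg im hn
    simp only [add_im, mul_im, ofReal_re, ofReal_im, zero_mul, add_zero, intCast_re, intCast_im,
      mul_re, I_re, I_im, mul_zero, mul_one, re_ofNat, im_ofNat, sub_zero] at hi
    obtain ⟨a1, a2⟩ := abs_lt.1 hs
    obtain ⟨b1, b2⟩ := abs_lt.1 him'
    have hn1 : n < 1 := by
      by_contra! hcon
      have : (1 : ℝ) ≤ n := by exact_mod_cast hcon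
      nlinarith
    have hn2 : -1 < n := by
      by_contra! hcon
      have : (n : ℝ) ≤ -1 := by exact_mod_cast hcon
      nlinarith
    obtain rfl : n = 0 := by omega
    refine hne (mul_left_cancel₀ hpc ?_)
    simpa using hn
  -- `k` is the denominator with its simple zero divided out, so the kernel is `N s / (s - s₀)` with
  -- `N` holomorphic on the strip. It splits as `N s₀ / (s - s₀)` plus the holomorphic `dslope N
  -- s₀`.
  set k : ℂ → ℂ := dslope D s₀ with hk
  set S : Set ℂ := {s | |s.im| < Real.pi} with hS
  have hSo : IsOpen S := isOpen_lt (by fun_prop) continuous_const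
  have hs₀S : S ∈ 𝓝 s₀ := hSo.mem_nhds (him'.trans h2)
  have hkd : DifferentiableOn ℂ k S :=
    (differentiableOn_dslope hs₀S).2 hDd.differentiableOn
  have hks₀ : k s₀ = p * w := by
    rw [hk, dslope_same]
    have : HasDerivAt D (exp (p * s₀) * (p * 1)) s₀ :=
      (((hasDerivAt_id s₀).const_mul (p : ℂ)).cexp).sub_const w
    rw [this.deriv, hexp]; ring
  have hkne : ∀ s, s ≠ s₀ → k s = D s / (s - s₀) := fun s hs => by
    rw [hk, dslope_of_ne _ hs, slope_def_field, hD0, sub_zero]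
  have hk0 : ∀ s ∈ S, k s ≠ 0 := by
    intro s hs
    by_cases hss : s = s₀
    · rw [hss, hks₀]; exact mul_ne_zero hpc hw
    · rw [hkne s hss]; exact div_ne_zero (hDs s hs hss) (sub_ne_zero.2 hss)
  set N : ℂ → ℂ := fun s => exp (exp s + s) / k s with hN
  have hNd : DifferentiableOn ℂ N S :=
    DifferentiableOn.div (Differentiable.differentiableOn (by fun_prop)) hkd hk0
  have hGd : DifferentiableOn ℂ (dslope N s₀) S := (differentiableOn_dslope hs₀S).2 hNd
  have hsub : ∀ s : ℂ, |s.im| ≤ θ → S ∈ 𝓝 s := fun s hs => hSo.mem_nhds (hs.trans_lt h2)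
  have hNs₀ : N s₀ = exp (exp s₀ + s₀) / (p * w) := by rw [hN]; simp only [hks₀]
  rw [scalarMittagLeffler_eq_lineDiff_add (R := 2 * Real.pi * I * N s₀) h1 h2 hp hw hκ
    (h.trans (le_abs_self _)), mul_add, inv_mul_cancel_left₀ two_pi_I_ne_zero, hNs₀]
  intro x₀ hx₀
  have hx₀' : s₀.re < x₀ := by
    rw [hre, div_lt_iff₀ hp, mul_comm, Real.log_lt_iff_lt_exp hw']; exact hx₀
  filter_upwards [eventually_lt_atBot s₀.re] with x₁ hx
  rw [rectIntegral_add (F := fun s => N s₀ * (s - s₀)⁻¹) (G := dslope N s₀) hx hx₀' him'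
    (fun s _ hs => ContinuousAt.mul continuousAt_const
      (ContinuousAt.inv₀ (by fun_prop) (sub_ne_zero.2 hs)))
    (fun s hs _ => (hGd.differentiableAt (hsub s hs)).continuousAt) ?_,
    rectIntegral_const_mul, rectIntegral_inv_sub hx hx₀' him',
    rectIntegral_eq_zero (hx.trans hx₀').le ((abs_nonneg _).trans him'.le)
      (fun s _ _ hs => hGd.differentiableAt (hsub s hs))]
  · ring
  · intro s hs hss
    have hss' := sub_ne_zero.2 hss
    rw [dslope_of_ne _ hss, slope_def_field]
    have : N s = mittagLefflerKernel p w s * (s - s₀) := by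
      rw [hN]
      simp only [hkne s hss, mittagLefflerKernel, hD]
      rw [div_div_eq_mul_div, mul_div_right_comm]
    rw [this]
    field_simp
    ring

/-! ### The algebraic expansion and its uniform remainder. -/

/-- The sum of the first `q` terms of the expansion of `-E_{p,p}` in powers of `1 / w`. -/
noncomputable def algebraicPart (p : ℝ) (q : ℕ) (w : ℂ) : ℂ :=
  ∑ k ∈ Finset.range q, (((Real.Gamma (-(p * k)))⁻¹ : ℝ) : ℂ) * w ^ (-(k : ℤ) - 1)

theorem one_div_sub_eq_neg_sum {v w : ℂ} (hw : w ≠ 0) (hvw : v - w ≠ 0) (q : ℕ) :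
    1 / (v - w) = -(∑ k ∈ Finset.range q, v ^ k * w ^ (-(k : ℤ) - 1)) +
      v ^ q / (v - w) * w ^ (-(q : ℤ)) := by
  induction q with
  | zero => simp
  | succ q ih =>
    have e1 : w ^ (-(q : ℤ)) = w ^ (-(q : ℤ) - 1) * w := by
      rw [← zpow_add_one₀ hw, sub_add_cancel]
    have e2 : w ^ (-((q + 1 : ℕ) : ℤ)) = w ^ (-(q : ℤ) - 1) := by congr 1; push_cast; ring
    rw [ih, Finset.sum_range_succ, e1, e2, pow_succ]
    field_simp
    ring

/-- A finite geometric expansion of `1 / (e^{ps} - w)` in powers of `1/w`; each term is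
`lineDiff_exp_exp` with `c = -pk`. -/
theorem lineDiff_mittagLefflerKernel {p θ κ : ℝ} {w : ℂ} (h1 : Real.pi / 2 < θ)
    (h2 : θ < Real.pi) (hp : 0 < p) (hw : w ≠ 0) (hκ : 0 < κ)
    (h : 2 * κ * ‖w‖ ≤ |w.re - ‖w‖ * Real.cos (p * θ)|) (q : ℕ) :
    lineDiff θ (mittagLefflerKernel p w) = -(2 * Real.pi * I * algebraicPart p q w) +
      lineDiff θ (fun s => exp (exp s + ((1 + p * q : ℝ) : ℂ) * s) / (exp (p * s) - w)) *
        w ^ (-(q : ℤ)) := by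
  have hθ : Real.cos θ < 0 := Real.cos_neg_of_pi_div_two_lt_of_lt h1 (by linarith [Real.pi_pos])
  have hb : ∀ k : ℕ, 0 < 1 + p * k := fun k => by positivity
  have line : ∀ ϕ : ℝ, ϕ = θ ∨ ϕ = -θ → ∫ x : ℝ, mittagLefflerKernel p w (x + ϕ * I) =
      -(∑ k ∈ Finset.range q, (∫ x : ℝ, exp (exp (x + ϕ * I) +
        ((1 + p * k : ℝ) : ℂ) * (x + ϕ * I))) * w ^ (-(k : ℤ) - 1)) +
      (∫ x : ℝ, exp (exp (x + ϕ * I) + ((1 + p * q : ℝ) : ℂ) * (x + ϕ * I)) /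
        (exp (p * (x + ϕ * I)) - w)) * w ^ (-(q : ℤ)) := by
    intro ϕ hϕ
    have hc : Real.cos ϕ < 0 := by rcases hϕ with rfl | rfl <;> simpa using hθ
    have i1 : ∀ k ∈ Finset.range q, Integrable fun x : ℝ => exp (exp (x + ϕ * I) +
        ((1 + p * k : ℝ) : ℂ) * (x + ϕ * I)) * w ^ (-(k : ℤ) - 1) := fun k _ =>
      (integrable_exp_exp_mul (hb k) hc).mul_const _
    have i2 := (integrable_exp_exp_mul_div hϕ (hb q) hw hκ hθ h).mul_const (w ^ (-(q : ℤ)))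
    simp only [← MeasureTheory.integral_mul_const]
    have i3 : Integrable fun x : ℝ => -∑ k ∈ Finset.range q, exp (exp (x + ϕ * I) +
        ((1 + p * k : ℝ) : ℂ) * (x + ϕ * I)) * w ^ (-(k : ℤ) - 1) :=
      (integrable_finsetSum _ i1).neg
    rw [← integral_finsetSum _ i1, ← MeasureTheory.integral_neg,
      ← MeasureTheory.integral_add i3 i2]
    refine MeasureTheory.integral_congr_ae (Eventually.of_forall fun x => ?_)
    have hne : exp (p * (x + ϕ * I)) - w ≠ 0 := norm_pos_iff.1
      ((mul_pos hκ (norm_pos_iff.2 hw)).trans_le (mul_norm_le_norm_exp_sub hϕ h x))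
    have hexp : ∀ k : ℕ, exp (exp (x + ϕ * I) + ((1 + p * k : ℝ) : ℂ) * (x + ϕ * I)) =
        exp (exp (x + ϕ * I) + (x + ϕ * I)) * exp (p * (x + ϕ * I)) ^ k := fun k => by
      rw [← exp_nat_mul, ← exp_add]; push_cast; ring_nf
    simp only [hexp, mittagLefflerKernel]
    rw [div_eq_mul_one_div, one_div_sub_eq_neg_sum hw hne q, mul_add, mul_neg, Finset.mul_sum]
    simp only [mul_assoc]
    ring
  have main : ∀ k : ℕ, lineDiff θ (fun s => exp (exp s + ((1 + p * k : ℝ) : ℂ) * s)) =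
      2 * Real.pi * I * (((Real.Gamma (-(p * k)))⁻¹ : ℝ) : ℂ) := fun k => by
    have := lineDiff_exp_exp (c := -(p * k)) h1 h2 (by linarith [hb k])
    rwa [sub_neg_eq_add] at this
  rw [lineDiff, line θ (Or.inl rfl), line (-θ) (Or.inr rfl), algebraicPart, Finset.mul_sum]
  simp only [← mul_assoc, ← main]
  simp only [lineDiff, sub_mul, Finset.sum_sub_distrib]
  ring

/-- On both lines the denominator is at least `κ ‖w‖`, which supplies the extra power of `‖w‖⁻¹` and
a constant independent of `w`. -/
theorem exists_norm_lineDiff_le {p θ κ : ℝ} (h1 : Real.pi / 2 < θ)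
    (h2 : θ < Real.pi) (hp : 0 < p) (hκ : 0 < κ) (q : ℕ) : ∃ C : ℝ, 0 ≤ C ∧ ∀ w : ℂ, w ≠ 0 →
      2 * κ * ‖w‖ ≤ |w.re - ‖w‖ * Real.cos (p * θ)| →
      ‖(2 * Real.pi * I)⁻¹ * lineDiff θ (mittagLefflerKernel p w) + algebraicPart p q w‖ ≤
        C * ‖w‖ ^ (-(q : ℤ) - 1) := by
  have hθ : Real.cos θ < 0 := Real.cos_neg_of_pi_div_two_lt_of_lt h1 (by linarith [Real.pi_pos])
  have ha : 0 < 1 + p * q := by positivity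
  set A : ℝ := ∫ x : ℝ, Real.exp (- -Real.cos θ * Real.exp x + (1 + p * q) * x) with hA
  have hA0 : 0 ≤ A := integral_nonneg fun x => (Real.exp_pos _).le
  refine ⟨‖(2 * Real.pi * I : ℂ)⁻¹‖ * (2 * (A * κ⁻¹)), by positivity, fun w hw h => ?_⟩
  have line : ∀ ϕ : ℝ, ϕ = θ ∨ ϕ = -θ →
      ‖∫ x : ℝ, exp (exp (x + ϕ * I) + ((1 + p * q : ℝ) : ℂ) * (x + ϕ * I)) /
        (exp (p * (x + ϕ * I)) - w)‖ ≤ A * (κ * ‖w‖)⁻¹ := fun ϕ hϕ => by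
    rw [hA, ← MeasureTheory.integral_mul_const]
    exact norm_integral_le_of_norm_le ((integrable_exp_neg_mul_exp (neg_pos.2 hθ) ha).mul_const _)
      (Eventually.of_forall (norm_mittagLefflerKernel_mul_le _ hϕ hw hκ h))
  rw [lineDiff_mittagLefflerKernel h1 h2 hp hw hκ h q, mul_add, mul_neg,
    inv_mul_cancel_left₀ two_pi_I_ne_zero, neg_add_eq_sub, sub_add_cancel, norm_mul, norm_mul,
    norm_zpow, mul_assoc ‖(2 * Real.pi * I : ℂ)⁻¹‖]
  refine mul_le_mul_of_nonneg_left ?_ (norm_nonneg _)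
  have hw' : ‖w‖ ≠ 0 := norm_ne_zero_iff.2 hw
  calc _ ≤ (A * (κ * ‖w‖)⁻¹ + A * (κ * ‖w‖)⁻¹) * ‖w‖ ^ (-(q : ℤ)) := by
        refine mul_le_mul_of_nonneg_right ?_ (by positivity)
        exact (norm_sub_le _ _).trans (add_le_add (line θ (Or.inl rfl)) (line (-θ) (Or.inr rfl)))
    _ = _ := by
        rw [zpow_sub_one₀ hw', mul_inv]; ring

end

open Filter Topology Complex

/-! ### Derivatives of the series, of the algebraic part and of the exponential. -/

theorem hasSum_deriv_power_series {a : ℕ → ℂ} (ha : ∀ z : ℂ, Summable fun k => a k * z ^ k)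
    (z : ℂ) : HasSum (fun k : ℕ => ((k + 1 : ℕ) : ℂ) * a (k + 1) * z ^ k)
      (deriv (fun w => ∑' k, a k * w ^ k) z) := by
  have hz : z ∈ Metric.ball (0 : ℂ) (‖z‖ + 1) := by simp
  have := hasSum_deriv_of_summable_norm (U := Metric.ball (0 : ℂ) (‖z‖ + 1))
    (F := fun k w => a k * w ^ k) (ha ((‖z‖ + 1 : ℝ) : ℂ)).norm
    (fun k => Differentiable.differentiableOn (by fun_prop)) Metric.isOpen_ball
    (fun k w hw => by
      rw [norm_mul, norm_mul, norm_pow, norm_pow, norm_real, Real.norm_of_nonneg (by positivity)]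
      gcongr
      exact (mem_ball_zero_iff.1 hw).le) hz
  rw [← hasSum_nat_add_iff' 1] at this
  simp only [Finset.range_one, Finset.sum_singleton, deriv_const_mul_field', deriv_pow_field,
    Nat.add_sub_cancel, Nat.cast_zero, zero_mul, mul_zero, sub_zero] at this
  convert! this using 2 with k
  ring

theorem hasSum_iteratedDeriv_power_series {a : ℕ → ℂ}
    (ha : ∀ z : ℂ, Summable fun k => a k * z ^ k) (m : ℕ) (z : ℂ) :
    HasSum (fun k : ℕ => ((k + m).descFactorial m : ℂ) * a (k + m) * z ^ k)
      (iteratedDeriv m (fun w => ∑' k, a k * w ^ k) z) := by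
  induction m generalizing a with
  | zero => simpa using (ha z).hasSum
  | succ m ih =>
    rw [iteratedDeriv_succ', show deriv (fun w => ∑' k, a k * w ^ k) =
      fun w => ∑' k : ℕ, ((k + 1 : ℕ) : ℂ) * a (k + 1) * w ^ k from
      funext fun w => (hasSum_deriv_power_series ha w).tsum_eq.symm]
    convert! ih (a := fun k => ((k + 1 : ℕ) : ℂ) * a (k + 1))
      (fun w => (hasSum_deriv_power_series ha w).summable) using 2 with k
    rw [← add_assoc, Nat.succ_descFactorial_succ]
    push_cast
    ring

theorem differentiable_power_series {a : ℕ → ℂ}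
    (ha : ∀ z : ℂ, Summable fun k => a k * z ^ k) :
    Differentiable ℂ fun w => ∑' k, a k * w ^ k := by
  intro z
  have hz : z ∈ Metric.ball (0 : ℂ) (‖z‖ + 1) := by simp
  refine (differentiableOn_tsum_of_summable_norm (U := Metric.ball (0 : ℂ) (‖z‖ + 1))
    (F := fun k w => a k * w ^ k) (ha ((‖z‖ + 1 : ℝ) : ℂ)).norm
    (fun k => Differentiable.differentiableOn (by fun_prop)) Metric.isOpen_ball
    (fun k w hw => ?_)).differentiableAt (Metric.isOpen_ball.mem_nhds hz)
  rw [norm_mul, norm_mul, norm_pow, norm_pow, norm_real, Real.norm_of_nonneg (by positivity)]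
  gcongr
  exact (mem_ball_zero_iff.1 hw).le

theorem prod_neg_sub_eq (j m : ℕ) :
    ∏ i ∈ Finset.range m, ((-((j : ℤ) + 1) : ℤ) - i : ℂ) = (-1) ^ m * (((j + m)! : ℂ) / (j ! : ℂ)) := by
  induction m with
  | zero => simp [Nat.factorial_ne_zero]
  | succ m ih =>
    rw [Finset.prod_range_succ, ih, ← add_assoc, Nat.factorial_succ]
    push_cast
    ring

theorem iteratedDeriv_algebraicPart {p t : ℝ} {q : ℕ} (hq : 1 ≤ q) (ht : 0 < t) {z : ℂ}
    (hz : z ≠ 0) (m : ℕ) :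
    iteratedDeriv m (fun w => algebraicPart p q ((t ^ p : ℝ) * w)) z = -deltaSum p q m t z := by
  have hc : ∀ k : ℕ, ContDiffAt ℂ m (fun w : ℂ => w ^ (-(k : ℤ) - 1)) z := fun k =>
    (analyticAt_id.zpow hz).contDiffAt
  simp only [algebraicPart, mul_zpow]
  rw [iteratedDeriv_fun_sum (fun k _ => contDiffAt_const.mul (contDiffAt_const.mul (hc k)))]
  simp only [iteratedDeriv_const_mul_field, iteratedDeriv_eq_iterate, iter_deriv_zpow]
  set h : ℕ → ℂ := fun j => (((Real.Gamma (p - p * j))⁻¹ : ℝ) : ℂ) *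
    (((t ^ p : ℝ) : ℂ) ^ (-(j : ℤ)) * ((-1) ^ m * (((j + m - 1)! : ℂ) / ((j - 1)! : ℂ)) *
      z ^ (-(j : ℤ) - m))) with hh
  have e1 : ∀ k : ℕ, (((Real.Gamma (-(p * k)))⁻¹ : ℝ) : ℂ) *
      (((t ^ p : ℝ) : ℂ) ^ (-(k : ℤ) - 1) * ((∏ i ∈ Finset.range m, (((-(k : ℤ) - 1 : ℤ) : ℂ) - i)) *
        z ^ (-(k : ℤ) - 1 - m))) = h (k + 1) := by
    intro k
    have := prod_neg_sub_eq k m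
    rw [neg_add'] at this
    rw [hh, this]
    simp only [Nat.add_sub_cancel, show k + 1 + m - 1 = k + m by omega]
    push_cast
    rw [neg_add', show p - p * (k + 1) = -(p * k) by ring]
  -- Here `Γ(p - p) = Γ(0)` is a pole, with inverse `0`: this is why `deltaSum` starts at `k = 2`.
  have e2 : h 1 = 0 := by simp [hh]
  rw [Finset.sum_congr rfl fun k _ => e1 k, Finset.range_eq_Ico, Finset.sum_Ico_add' h 0 q 1,
    zero_add, Finset.sum_eq_sum_Ico_succ_bot (by omega), e2, zero_add, deltaSum,
    ← Finset.sum_neg_distrib]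
  refine Finset.sum_congr (by ext j; simp) fun j _ => ?_
  have e3 : ((t ^ p : ℝ) : ℂ) ^ (-(j : ℤ)) = ((t ^ (-(p * j)) : ℝ) : ℂ) := by
    rw [← ofReal_zpow, ← Real.rpow_intCast, ← Real.rpow_mul ht.le]
    push_cast
    ring_nf
  simp only [hh, e3, pow_succ]
  push_cast
  ring

/-- The residue at `t^p w` is itself a first derivative in `w`, hence the order `m + 1` in
`psiTilde` and the prefactor `t^{-p}`. -/
theorem deriv_exp_mul_cpow {p t : ℝ} (hp : 0 < p) (ht : 0 < t) {w : ℂ} (hw : w ∈ slitPlane) :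
    ((t ^ (-p) : ℝ) : ℂ) * deriv (fun v : ℂ => exp (t * v ^ ((1 / p : ℝ) : ℂ))) w =
      exp (exp (log ((t ^ p : ℝ) * w) / p) + log ((t ^ p : ℝ) * w) / p) /
        (p * ((t ^ p : ℝ) * w)) := by
  have hw0 := slitPlane_ne_zero hw
  have hpc : (p : ℂ) ≠ 0 := ofReal_ne_zero.2 hp.ne'
  have htp : ((t ^ p : ℝ) : ℂ) ≠ 0 := ofReal_ne_zero.2 (Real.rpow_pos_of_pos ht p).ne'
  have hlog : exp (log ((t ^ p : ℝ) * w) / p) = t * w ^ ((1 / p : ℝ) : ℂ) := by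
    rw [log_ofReal_mul (Real.rpow_pos_of_pos ht p) hw0, Real.log_rpow ht, cpow_def_of_ne_zero hw0]
    push_cast
    rw [add_div, mul_div_cancel_left₀ _ hpc, exp_add, ← ofReal_exp, Real.exp_log ht]
    ring_nf
  have hd : HasDerivAt (fun v : ℂ => exp (t * v ^ ((1 / p : ℝ) : ℂ)))
      (exp (t * w ^ ((1 / p : ℝ) : ℂ)) * (t * (((1 / p : ℝ) : ℂ) * w ^ (((1 / p : ℝ) : ℂ) - 1) * 1))) w :=
    (((hasDerivAt_id w).cpow_const hw).const_mul (t : ℂ)).cexp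
  rw [hd.deriv, exp_add, hlog, cpow_sub _ _ hw0, cpow_one, Real.rpow_neg ht.le]
  push_cast at htp ⊢
  field_simp

/-! ### Cauchy estimates, uniform on cones. -/

/-- By the 2-Lipschitz property the right side drops by at most `2c‖z‖ ≤ 4κ‖z‖`. What is left,
`4κ‖z‖`, is at least `2κ‖w‖` since `‖w‖ ≤ 2‖z‖`. -/
theorem cone_of_norm_sub_le {a κ c ε : ℝ} {z w : ℂ} (hε : ε = 1 ∨ ε = -1) (ha : |a| ≤ 1)
    (hκ : 0 ≤ κ) (hz : 8 * κ * ‖z‖ ≤ ε * (z.re - ‖z‖ * a)) (hc1 : c ≤ 1) (hc : c ≤ 2 * κ)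
    (hw : ‖w - z‖ ≤ c * ‖z‖) : 2 * κ * ‖w‖ ≤ ε * (w.re - ‖w‖ * a) := by
  have e : w.re - ‖w‖ * a = z.re - ‖z‖ * a + ((w - z).re - (‖w‖ - ‖z‖) * a) := by
    rw [sub_re]; ring
  have h1 := abs_re_le_norm (w - z)
  have h2 : |(‖w‖ - ‖z‖) * a| ≤ ‖w - z‖ := by
    rw [abs_mul]
    nlinarith [abs_norm_sub_norm_le w z, abs_nonneg a, abs_nonneg (‖w‖ - ‖z‖)]
  have h3 : |(w - z).re - (‖w‖ - ‖z‖) * a| ≤ 2 * (c * ‖z‖) :=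
    (abs_sub _ _).trans (by linarith)
  have h4 : -(2 * (c * ‖z‖)) ≤ ε * ((w - z).re - (‖w‖ - ‖z‖) * a) := by
    obtain ⟨h5, h6⟩ := abs_le.1 h3
    rcases hε with rfl | rfl <;> linarith
  have h5 : ‖w‖ ≤ 2 * ‖z‖ := by
    have := norm_sub_norm_le w z
    nlinarith [norm_nonneg z]
  have h6 : c * ‖z‖ ≤ 2 * κ * ‖z‖ := by gcongr
  rw [e, mul_add]
  nlinarith

theorem summable_rescaled {p : ℝ} (hp : 0 < p) (τ : ℂ) (z : ℂ) :
    Summable fun k : ℕ => (((Real.Gamma (p * k + p))⁻¹ : ℝ) : ℂ) * τ ^ k * z ^ k := by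
  simpa only [mul_pow, mul_assoc] using summable_scalarMittagLeffler hp (τ * z)

theorem scalarMittagLeffler_mul_eq (p : ℝ) (τ : ℂ) :
    (fun w => scalarMittagLeffler p (τ * w)) =
      fun w => ∑' k : ℕ, (((Real.Gamma (p * k + p))⁻¹ : ℝ) : ℂ) * τ ^ k * w ^ k := by
  funext w
  simp only [scalarMittagLeffler, mul_pow, mul_assoc]

theorem differentiable_scalarMittagLeffler_mul {p : ℝ} (hp : 0 < p) (τ : ℂ) :
    Differentiable ℂ fun w => scalarMittagLeffler p (τ * w) := by
  rw [scalarMittagLeffler_mul_eq]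
  exact differentiable_power_series (summable_rescaled hp τ)

/-- The pair `(ε, u)` merges the two cases: `(-1, 0)` is stable, `(1, 1)` unstable. -/
theorem exists_norm_scalarMittagLeffler_sub_le {p θ κ : ℝ} (h1 : Real.pi / 2 < θ)
    (h2 : θ < Real.pi) (hp : 0 < p) (hp1 : p < 1) (hκ : 0 < κ) (q : ℕ) :
    ∃ C : ℝ, 0 ≤ C ∧ ∀ (ε : ℝ) (u : ℂ), (ε = -1 ∧ u = 0) ∨ (ε = 1 ∧ u = 1) → ∀ w : ℂ, w ≠ 0 →
      2 * κ * ‖w‖ ≤ ε * (w.re - ‖w‖ * Real.cos (p * θ)) →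
      ‖scalarMittagLeffler p w - u * (exp (exp (log w / p) + log w / p) / (p * w)) +
        algebraicPart p q w‖ ≤ C * ‖w‖ ^ (-(q : ℤ) - 1) := by
  obtain ⟨C, hC, H⟩ := exists_norm_lineDiff_le h1 h2 hp hκ q
  refine ⟨C, hC, ?_⟩
  rintro ε u (⟨rfl, rfl⟩ | ⟨rfl, rfl⟩) w hw h
  · have := H w hw (h.trans (by rw [neg_one_mul]; exact neg_le_abs _))
    rwa [zero_mul, sub_zero,
      scalarMittagLeffler_eq_of_stable h1 h2 hp hp1 hw hκ (by linarith)]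
  · rw [one_mul] at h
    have := H w hw (h.trans (le_abs_self _))
    rwa [one_mul, scalarMittagLeffler_eq_of_unstable h1 h2 hp hp1 hw hκ h, add_sub_cancel_right]

/-- The remainder of the expansion of the `m`-th derivative of `z ↦ E_{p,p}(t ^ p z)`, for `z` in
one of the two closed cones bounded away from the rays `|arg z| = p θ`. -/
theorem exists_norm_iteratedDeriv_sub_le {p θ κ : ℝ} (h1 : Real.pi / 2 < θ)
    (h2 : θ < Real.pi) (hp : 0 < p) (hp1 : p < 1) (hκ : 0 < κ) {q : ℕ} (hq : 1 ≤ q) (m : ℕ) :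
    ∃ K : ℝ, 0 ≤ K ∧ ∀ (ε : ℝ) (u : ℂ), (ε = -1 ∧ u = 0) ∨ (ε = 1 ∧ u = 1) → ∀ z : ℂ, z ≠ 0 →
      8 * κ * ‖z‖ ≤ ε * (z.re - ‖z‖ * Real.cos (p * θ)) → ∀ t : ℝ, 0 < t →
      ‖iteratedDeriv m (fun w => scalarMittagLeffler p ((t ^ p : ℝ) * w)) z -
          u * (((t ^ (-p) : ℝ) : ℂ) *
            iteratedDeriv (m + 1) (fun v : ℂ => exp (t * v ^ ((1 / p : ℝ) : ℂ))) z) -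
          deltaSum p q m t z‖ ≤
        K * (‖z‖ ^ (-(q : ℤ) - 1 - m) * t ^ (-p - p * q)) := by
  obtain ⟨C, hC, H⟩ := exists_norm_scalarMittagLeffler_sub_le h1 h2 hp hp1 hκ q
  -- The bound `1/2` keeps the disc of radius `c ‖z‖` away from `0`, the bound `2κ` keeps it in the
  -- wider cone.
  set c : ℝ := min (1 / 2) (2 * κ) with hc
  have hc2 : c ≤ 1 / 2 := min_le_left _ _
  have hc0 : 0 < c := lt_min (by norm_num) (by positivity)
  refine ⟨m ! * (C * (1 / 2) ^ (-(q : ℤ) - 1)) / c ^ m, by positivity, ?_⟩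
  intro ε u hε z hz hcone t ht
  have hz' := norm_pos_iff.2 hz
  have hε' : ε = 1 ∨ ε = -1 := by
    rcases hε with h | h
    · exact Or.inr h.1
    · exact Or.inl h.1
  set τ : ℝ := t ^ p with hτ
  have hτ0 : 0 < τ := Real.rpow_pos_of_pos ht p
  have hτc : (τ : ℂ) ≠ 0 := ofReal_ne_zero.2 hτ0.ne'
  set ϕ : ℂ → ℂ := fun v => exp (t * v ^ ((1 / p : ℝ) : ℂ)) with hϕ
  have hball : ∀ w ∈ Metric.closedBall z (c * ‖z‖),
      2 * κ * ‖w‖ ≤ ε * (w.re - ‖w‖ * Real.cos (p * θ)) := fun w hw =>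
    cone_of_norm_sub_le hε' (Real.abs_cos_le_one _) hκ.le hcone
      (hc2.trans (by norm_num)) (min_le_right _ _)
      (by rwa [← dist_eq_norm, ← Metric.mem_closedBall])
  have hhalf : ∀ w ∈ Metric.closedBall z (c * ‖z‖), 1 / 2 * ‖z‖ ≤ ‖w‖ := fun w hw => by
    have e1 : ‖w - z‖ ≤ c * ‖z‖ := by rwa [← dist_eq_norm, ← Metric.mem_closedBall]
    have e2 := norm_sub_norm_le z w
    rw [norm_sub_rev] at e2
    have e3 : c * ‖z‖ ≤ 1 / 2 * ‖z‖ := by gcongr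
    linarith
  have hne : ∀ w ∈ Metric.closedBall z (c * ‖z‖), w ≠ 0 := fun w hw =>
    norm_pos_iff.1 ((by positivity : 0 < 1 / 2 * ‖z‖).trans_le (hhalf w hw))
  -- On the closed negative axis `Re w = -‖w‖`, which the unstable cone excludes as `cos ≥ -1`; the
  -- principal power is thus analytic on the disc.
  have hslit : ∀ w ∈ Metric.closedBall z (c * ‖z‖), u = 1 → w ∈ slitPlane := by
    intro w hw hu
    obtain rfl : ε = 1 := by
      rcases hε with h | h
      · exact absurd (hu.symm.trans h.2) one_ne_zero
      · exact h.1
    have h3 := hball w hw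
    have h4 := norm_pos_iff.2 (hne w hw)
    have h5 := Real.neg_one_le_cos (p * θ)
    rw [mem_slitPlane_iff]
    by_contra! hcon
    have h6 : ‖w‖ = -w.re := by
      rw [← abs_of_nonpos hcon.1, eq_comm, abs_re_eq_norm]; exact hcon.2
    have h7 : 0 < κ * ‖w‖ := by positivity
    nlinarith
  have hϕan : ∀ w ∈ Metric.closedBall z (c * ‖z‖), u = 1 → AnalyticAt ℂ ϕ w := fun w hw hu => by
    have : w ∈ slitPlane := hslit w hw hu
    fun_prop (disch := assumption)
  have hu01 : u = 0 ∨ u = 1 := by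
    rcases hε with h | h
    · exact Or.inl h.2
    · exact Or.inr h.2
  set f : ℂ → ℂ := fun w => scalarMittagLeffler p (τ * w) with hf
  set B : ℂ → ℂ := fun w => u * (((t ^ (-p) : ℝ) : ℂ) * deriv ϕ w) with hB
  set A : ℂ → ℂ := fun w => algebraicPart p q (τ * w) with hA
  have hfd : Differentiable ℂ f := differentiable_scalarMittagLeffler_mul hp τ
  have hBan : ∀ w ∈ Metric.closedBall z (c * ‖z‖), AnalyticAt ℂ B w := fun w hw => by
    rcases hu01 with h | h
    · simp only [hB, h, zero_mul]; exact analyticAt_const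
    · exact analyticAt_const.mul (analyticAt_const.mul (hϕan w hw h).deriv)
  have hAan : ∀ w : ℂ, w ≠ 0 → AnalyticAt ℂ A w := fun w hw => by
    refine Finset.analyticAt_fun_sum _ fun k _ => analyticAt_const.mul ?_
    exact AnalyticAt.zpow (by fun_prop) (mul_ne_zero hτc hw)
  have hzmem : z ∈ Metric.closedBall z (c * ‖z‖) := Metric.mem_closedBall_self (by positivity)
  have hcauchy : ‖iteratedDeriv m (f - B + A) z‖ ≤
      m ! * (C * (τ * (1 / 2 * ‖z‖)) ^ (-(q : ℤ) - 1)) / (c * ‖z‖) ^ m := by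
    refine norm_iteratedDeriv_le_of_forall_mem_sphere_norm_le m (by positivity) ?_ ?_
    · refine DifferentiableOn.diffContOnCl fun w hw => ?_
      have hw' := Metric.closure_ball_subset_closedBall hw
      exact (((hfd w).sub (hBan w hw').differentiableAt).add
        (hAan w (hne w hw')).differentiableAt).differentiableWithinAt
    · intro w hw
      have hw' := Metric.sphere_subset_closedBall hw
      have hcw := hball w hw'
      -- The cone condition is invariant under positive scaling.
      have hτw : 2 * κ * ‖(τ : ℂ) * w‖ ≤
          ε * (((τ : ℂ) * w).re - ‖(τ : ℂ) * w‖ * Real.cos (p * θ)) := by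
        rw [norm_mul, norm_real, Real.norm_of_nonneg hτ0.le, re_ofReal_mul]
        nlinarith
      have key := H ε u hε (τ * w) (mul_ne_zero hτc (hne w hw')) hτw
      have hBw : B w = u * (exp (exp (log (τ * w) / p) + log (τ * w) / p) / (p * (τ * w))) := by
        rcases hu01 with h | h
        · simp [hB, h]
        · simp only [hB, hϕ, hτ]
          rw [deriv_exp_mul_cpow hp ht (hslit w hw' h)]
      simp only [Pi.add_apply, Pi.sub_apply, hBw]
      refine key.trans (mul_le_mul_of_nonneg_left ?_ hC)
      rw [norm_mul, norm_real, Real.norm_of_nonneg hτ0.le]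
      have e : ∀ x : ℝ, x ^ (-(q : ℤ) - 1) = (x ^ (q + 1))⁻¹ := fun x => by
        rw [← zpow_natCast, ← zpow_neg]; congr 1; push_cast; ring
      rw [e, e]
      have := hhalf w hw'
      exact inv_anti₀ (by positivity) (by gcongr)
  have hsplit : iteratedDeriv m (f - B + A) z = iteratedDeriv m f z -
      u * (((t ^ (-p) : ℝ) : ℂ) * iteratedDeriv (m + 1) ϕ z) - deltaSum p q m t z := by
    have hfB : ContDiffAt ℂ m (f - B) z :=
      hfd.contDiff.contDiffAt.sub (hBan z hzmem).contDiffAt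
    rw [iteratedDeriv_add hfB
      (hAan z hz).contDiffAt, iteratedDeriv_sub hfd.contDiff.contDiffAt (hBan z hzmem).contDiffAt,
      iteratedDeriv_algebraicPart hq ht hz, ← sub_eq_add_neg, iteratedDeriv_succ']
    simp only [hB, iteratedDeriv_const_mul_field]
  rw [← hsplit]
  refine hcauchy.trans_eq ?_
  have e1 : τ ^ (-(q : ℤ) - 1) = t ^ (-p - p * q) := by
    rw [hτ, ← Real.rpow_intCast, ← Real.rpow_mul ht.le]
    push_cast
    ring_nf
  have e2 : ‖z‖ ^ (-(q : ℤ) - 1 - m) = ‖z‖ ^ (-(q : ℤ) - 1) / ‖z‖ ^ m := by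
    rw [zpow_sub₀ hz'.ne', zpow_natCast]
  rw [mul_zpow, mul_zpow, e1, e2, mul_pow]
  field_simp

/-- A choice of the contour angle and of the cone aperture that fits a given distance from the
critical rays. -/
theorem exists_angle_cone {p δ : ℝ} (hp : 0 < p) (hp1 : p < 1) (hδ : 0 < δ) :
    ∃ θ κ : ℝ, Real.pi / 2 < θ ∧ θ < Real.pi ∧ 0 < κ ∧ ∀ z : ℂ,
      δ ≤ |(|arg z| - p * Real.pi / 2)| →
      (p * Real.pi / 2 < |arg z| ∧ 8 * κ * ‖z‖ ≤ -1 * (z.re - ‖z‖ * Real.cos (p * θ))) ∨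
      (¬p * Real.pi / 2 < |arg z| ∧ 8 * κ * ‖z‖ ≤ 1 * (z.re - ‖z‖ * Real.cos (p * θ))) := by
  have hpi := Real.pi_pos
  -- `π/4` ensures `θ < π`; `δ/2` puts `pθ` strictly between `pπ/2` and `pπ/2 + δ`. The aperture `κ`
  -- then comes from the gaps between the cosines.
  set η : ℝ := min (Real.pi / 4) (δ / 2) with hη
  have hη0 : 0 < η := lt_min (by positivity) (by positivity)
  have hη1 : η ≤ Real.pi / 4 := min_le_left _ _
  have hη2 : η ≤ δ / 2 := min_le_right _ _
  set θ : ℝ := Real.pi / 2 + η with hθ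
  set β : ℝ := min (p * Real.pi / 2 + δ) Real.pi with hβ
  have hpθ : p * θ < Real.pi := by nlinarith
  have hθ1 : p * Real.pi / 2 < p * θ := by rw [hθ]; nlinarith
  have hθβ : p * θ < β := lt_min (by rw [hθ]; nlinarith) hpθ
  have d1 : Real.cos β < Real.cos (p * θ) :=
    Real.cos_lt_cos_of_nonneg_of_le_pi (by positivity) (min_le_right _ _) hθβ
  have d2 : Real.cos (p * θ) < Real.cos (p * Real.pi / 2) :=
    Real.cos_lt_cos_of_nonneg_of_le_pi (by positivity) hpθ.le hθ1
  refine ⟨θ, min (Real.cos (p * θ) - Real.cos β) (Real.cos (p * Real.pi / 2) - Real.cos (p * θ)) / 8,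
    by linarith, by linarith, div_pos (lt_min (by linarith) (by linarith)) (by norm_num),
    fun z hz => ?_⟩
  have hre := norm_mul_cos_arg z
  rw [← Real.cos_abs] at hre
  rw [mul_div_cancel₀ _ (by norm_num : (8 : ℝ) ≠ 0)]
  by_cases hst : p * Real.pi / 2 < |arg z|
  · refine Or.inl ⟨hst, ?_⟩
    rw [abs_of_pos (by linarith)] at hz
    have h3 : Real.cos |arg z| ≤ Real.cos β := Real.cos_le_cos_of_nonneg_of_le_pi
      (le_min (by positivity) hpi.le) (abs_arg_le_pi z) ((min_le_left _ _).trans (by linarith))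
    have h4 : min (Real.cos (p * θ) - Real.cos β) (Real.cos (p * Real.pi / 2) - Real.cos (p * θ)) ≤
      Real.cos (p * θ) - Real.cos |arg z| := (min_le_left _ _).trans (by linarith)
    rw [← hre]
    nlinarith [norm_nonneg z]
  · refine Or.inr ⟨hst, ?_⟩
    have h3 : Real.cos (p * Real.pi / 2) ≤ Real.cos |arg z| := Real.cos_le_cos_of_nonneg_of_le_pi
      (abs_nonneg _) (by nlinarith) (not_lt.1 hst)
    have h4 : min (Real.cos (p * θ) - Real.cos β) (Real.cos (p * Real.pi / 2) - Real.cos (p * θ)) ≤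
      Real.cos |arg z| - Real.cos (p * θ) := (min_le_right _ _).trans (by linarith)
    rw [← hre]
    nlinarith [norm_nonneg z]

/-! ### Jordan blocks and assembly. -/

/-- The binomial theorem for `z` plus the nilpotent shift, proved through Pascal's rule. For `d > k`
the truncated exponent `k - d` is harmless, the binomial coefficient being zero. -/
theorem jordanBlock_pow (n : ℕ) (z : ℂ) (k : ℕ) :
    jordanBlock n z ^ k = upperToeplitz n fun d => (k.choose d : ℂ) * z ^ (k - d) := by
  induction k with
  | zero =>
    ext i j
    rw [pow_zero, Matrix.one_apply, upperToeplitz, Matrix.of_apply]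
    rcases lt_trichotomy i j with h | rfl | h
    · have : (j : ℕ) - i ≠ 0 := by have := Fin.lt_def.1 h; omega
      rw [if_neg h.ne, if_pos h.le, Nat.choose_eq_zero_of_lt (Nat.pos_of_ne_zero this)]
      simp
    · simp
    · rw [if_neg h.ne', if_neg (not_le.2 h)]
  | succ k ih =>
    ext i j
    have hJ : ∀ l : Fin n, jordanBlock n z l j =
        (if l = j then z else 0) + if (l : ℕ) + 1 = j then 1 else 0 := fun l => by
      rw [jordanBlock, Matrix.of_apply]
      split_ifs with h1 h2 h2
      · subst h1; omega
      all_goals simp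
    rw [pow_succ, Matrix.mul_apply, ih]
    simp only [hJ, mul_add, Finset.sum_add_distrib, mul_ite, mul_zero, mul_one,
      Finset.sum_ite_eq', Finset.mem_univ, if_true]
    simp only [upperToeplitz, Matrix.of_apply]
    obtain ⟨i, hi⟩ := i
    obtain ⟨j, hj⟩ := j
    simp only [Fin.mk_le_mk]
    cases j with
    | zero =>
      rw [Finset.sum_eq_zero (fun l _ => if_neg (by simp))]
      rcases Nat.eq_zero_or_pos i with rfl | h
      · simp [pow_succ]
      · simp [h.ne']
    | succ j =>
      rw [Finset.sum_eq_single (⟨j, by omega⟩ : Fin n)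
        (fun l _ hl => if_neg fun h => hl (Fin.ext (by simpa using h))) (by simp)]
      simp only [if_true, Fin.le_def]
      rcases lt_trichotomy i (j + 1) with h | rfl | h
      · obtain ⟨d, rfl⟩ : ∃ d, j = i + d := ⟨j - i, by omega⟩
        rw [if_pos h.le, if_pos (by omega), if_pos h.le,
          show i + d + 1 - i = d + 1 by omega, show i + d - i = d by omega,
          Nat.choose_succ_succ, Nat.add_sub_add_right]
        rcases lt_or_ge k (d + 1) with hk | hk
        · rw [Nat.choose_eq_zero_of_lt hk]; simp
        · obtain ⟨e, rfl⟩ : ∃ e, k = d + 1 + e := ⟨k - (d + 1), by omega⟩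
          rw [show d + 1 + e - d = e + 1 by omega, show d + 1 + e - (d + 1) = e by omega]
          push_cast; ring
      · simp [pow_succ]
      · rw [if_neg (by omega), if_neg (by omega), if_neg (by omega), zero_mul, zero_add]

/-- Since `k.choose m * z ^ (k - m)` is the `m`-th derivative of `z ^ k` over `m!`, each
superdiagonal carries a differentiated scalar series. -/
theorem hasSum_mittagLefflerTerm_jordanBlock {p : ℝ} (hp : 0 < p) (τ : ℂ) (n : ℕ) (z : ℂ) :
    HasSum (mittagLefflerTerm p p (τ • jordanBlock n z))
      (upperToeplitz n fun m =>
        (1 / (m ! : ℂ)) * iteratedDeriv m (fun w => scalarMittagLeffler p (τ * w)) z) := by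
  refine Pi.hasSum.2 fun i => Pi.hasSum.2 fun j => ?_
  simp only [mittagLefflerTerm, smul_pow, jordanBlock_pow, Matrix.smul_apply, upperToeplitz,
    Matrix.of_apply, smul_eq_mul]
  split_ifs with hij
  · set m : ℕ := (j : ℕ) - i with hm
    rw [scalarMittagLeffler_mul_eq, ← hasSum_nat_add_iff' m, Finset.sum_eq_zero fun k hk => by
      rw [Nat.choose_eq_zero_of_lt (Finset.mem_range.1 hk)]; simp, sub_zero]
    convert! (hasSum_iteratedDeriv_power_series (summable_rescaled hp τ) m z).mul_left
      (1 / (m ! : ℂ)) using 2 with k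
    have hm : (m ! : ℂ) ≠ 0 := Nat.cast_ne_zero.2 m.factorial_ne_zero
    rw [Nat.descFactorial_eq_factorial_mul_choose, Nat.add_sub_cancel]
    push_cast
    field_simp
  · simp [hasSum_zero]

theorem mittagLefflerTerm_blockDiagonal' {l : ℕ} (n : Fin l → ℕ)
    (M : ∀ j, Matrix (Fin (n j)) (Fin (n j)) ℂ) (a b : ℝ) (τ : ℂ) :
    mittagLefflerTerm a b (τ • Matrix.blockDiagonal' M) =
      fun k => Matrix.blockDiagonal' fun j => mittagLefflerTerm a b (τ • M j) k := by
  funext k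
  have h1 : τ • Matrix.blockDiagonal' M = Matrix.blockDiagonal' (τ • M) :=
    (Matrix.blockDiagonal'_smul τ M).symm
  rw [mittagLefflerTerm, h1, ← Matrix.blockDiagonal'_pow, ← Matrix.blockDiagonal'_smul]
  rfl

theorem upperToeplitz_smul_add (n : ℕ) (s : ℂ) (a b : ℕ → ℂ) :
    s • upperToeplitz n a + upperToeplitz n b = upperToeplitz n fun m => s * a m + b m := by
  ext i j
  simp only [upperToeplitz, Matrix.add_apply, Matrix.smul_apply, Matrix.of_apply, smul_eq_mul]
  split_ifs <;> simp

theorem lemma4 (p : ℝ) (hp0 : 0 < p) (hp1 : p < 1) (q : ℕ) (hq : 2 ≤ q)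
    (r δ : ℝ) (hr : 0 < r) (hδ : 0 < δ) :
    ∃ K T : ℕ → ℝ, ∀ (l : ℕ) (n : Fin l → ℕ) (ev : Fin l → ℂ),
      (∀ j, r ≤ ‖ev j‖) →
      (∀ j, δ ≤ |(|Complex.arg (ev j)| - p * Real.pi / 2)|) →
      ∃ ρ : Fin l → ℕ → ℝ → ℂ,
        (∀ (j : Fin l) (m : ℕ), m < n j → ∀ t : ℝ, T m ≤ t →
          ‖ρ j m t‖ ≤ K m * (‖ev j‖ ^ (-(q : ℝ) - (m : ℝ)) * t ^ (-p - p * q))) ∧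
        ∀ t : ℝ, 0 < t →
          (∀ j : Fin l,
            Summable (mittagLefflerTerm p p (((t ^ p : ℝ) : ℂ) • jordanBlock (n j) (ev j))) ∧
            mittagLeffler p p (((t ^ p : ℝ) : ℂ) • jordanBlock (n j) (ev j)) =
              ((t ^ (-p) : ℝ) : ℂ) • blockB p (n j) (ev j) t +
                blockC p q (n j) (ev j) (ρ j) t) ∧
          Summable (mittagLefflerTerm p p (((t ^ p : ℝ) : ℂ) •
            Matrix.blockDiagonal' fun j => jordanBlock (n j) (ev j))) ∧
          mittagLeffler p p (((t ^ p : ℝ) : ℂ) •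
              Matrix.blockDiagonal' fun j => jordanBlock (n j) (ev j)) =
            ((t ^ (-p) : ℝ) : ℂ) • (Matrix.blockDiagonal' fun j => blockB p (n j) (ev j) t) +
              Matrix.blockDiagonal' fun j => blockC p q (n j) (ev j) (ρ j) t := by
  obtain ⟨θ, κ, h1, h2, hκ, hcone⟩ := exists_angle_cone hp0 hp1 hδ
  choose K hK hbound using fun m : ℕ =>
    exists_norm_iteratedDeriv_sub_le h1 h2 hp0 hp1 hκ (show 1 ≤ q by omega) m
  -- The scalar remainder has one more factor `‖ev j‖⁻¹`, absorbed as `r⁻¹`. It is bounded for all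
  -- `t > 0`, so the threshold `1` is arbitrary.
  refine ⟨fun m => K m * r⁻¹, fun _ => 1, fun l n ev hev harg => ?_⟩
  have hev0 : ∀ j, ev j ≠ 0 := fun j => norm_pos_iff.1 (hr.trans_le (hev j))
  set u : Fin l → ℂ := fun j => if p * Real.pi / 2 < |arg (ev j)| then 0 else 1 with hu
  -- `ρ` is by definition what makes the identity exact; the content lies in its bound.
  set ρ : Fin l → ℕ → ℝ → ℂ := fun j m t =>
    iteratedDeriv m (fun w => scalarMittagLeffler p ((t ^ p : ℝ) * w)) (ev j) -
      u j * (((t ^ (-p) : ℝ) : ℂ) *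
        iteratedDeriv (m + 1) (fun v : ℂ => exp (t * v ^ ((1 / p : ℝ) : ℂ))) (ev j)) -
      deltaSum p q m t (ev j) with hρ
  refine ⟨ρ, fun j m _ t ht => ?_, fun t ht => ?_⟩
  · have ht0 : 0 < t := one_pos.trans_le ht
    have hz := norm_pos_iff.2 (hev0 j)
    have hmain : ‖ρ j m t‖ ≤ K m * (‖ev j‖ ^ (-(q : ℤ) - 1 - m) * t ^ (-p - p * q)) := by
      rcases hcone (ev j) (harg j) with ⟨ha, hc⟩ | ⟨ha, hc⟩
      · exact hbound m (-1) (u j) (Or.inl ⟨rfl, by simp only [hu, if_pos ha]⟩) (ev j) (hev0 j) hc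
          t ht0
      · exact hbound m 1 (u j) (Or.inr ⟨rfl, by simp only [hu, if_neg ha]⟩) (ev j) (hev0 j) hc
          t ht0
    refine hmain.trans ?_
    rw [mul_assoc (K m)]
    refine mul_le_mul_of_nonneg_left ?_ (hK m)
    rw [← mul_assoc]
    refine mul_le_mul_of_nonneg_right ?_ (Real.rpow_nonneg ht0.le _)
    have e : ‖ev j‖ ^ (-(q : ℤ) - 1 - m) = ‖ev j‖⁻¹ * ‖ev j‖ ^ (-(q : ℝ) - (m : ℝ)) := by
      rw [← Real.rpow_intCast, ← Real.rpow_neg_one, ← Real.rpow_add hz]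
      push_cast
      ring_nf
    rw [e]
    refine mul_le_mul_of_nonneg_right ?_ (Real.rpow_nonneg hz.le _)
    exact inv_anti₀ hr (hev j)
  · have hblock : ∀ j, HasSum (mittagLefflerTerm p p (((t ^ p : ℝ) : ℂ) • jordanBlock (n j) (ev j)))
        (((t ^ (-p) : ℝ) : ℂ) • blockB p (n j) (ev j) t + blockC p q (n j) (ev j) (ρ j) t) := by
      intro j
      convert! hasSum_mittagLefflerTerm_jordanBlock hp0 ((t ^ p : ℝ) : ℂ) (n j) (ev j) using 1
      have hB : blockB p (n j) (ev j) t = upperToeplitz (n j) fun m => u j * psiTilde p m t (ev j) := by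
        rw [blockB]
        by_cases ha : p * Real.pi / 2 < |arg (ev j)|
        · ext; simp [hu, ha, upperToeplitz]
        · simp only [hu, if_neg ha, one_mul]
      rw [hB, blockC, upperToeplitz_smul_add]
      congr 1
      funext m
      simp only [hρ, psiTilde]
      ring
    have htot : HasSum (mittagLefflerTerm p p (((t ^ p : ℝ) : ℂ) •
        Matrix.blockDiagonal' fun j => jordanBlock (n j) (ev j)))
        (((t ^ (-p) : ℝ) : ℂ) • (Matrix.blockDiagonal' fun j => blockB p (n j) (ev j) t) +
          Matrix.blockDiagonal' fun j => blockC p q (n j) (ev j) (ρ j) t) := by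
      rw [mittagLefflerTerm_blockDiagonal', ← Matrix.blockDiagonal'_smul,
        ← Matrix.blockDiagonal'_add]
      exact HasSum.matrix_blockDiagonal' (Pi.hasSum.2 hblock)
    exact ⟨fun j => ⟨(hblock j).summable, (hblock j).tsum_eq⟩, htot.summable, htot.tsum_eq⟩
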